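/- Let $k$ be a field, $n\ge 2$, $d\ge 2$, $R=k[x_1,\dots,x_n]$, and let $f,g\in R$ be homogeneous polynomials with $\deg f=d-1$, $\deg g=d$ and $\gcd(f,g)=1$. Let $I=(fx_1,\dots,fx_n,g)$ and $B=R[y_1,\dots,y_{n+1}]$, bigraded by $\operatorname{bideg}x_i=(1,0)$ and $\operatorname{bideg}y_j=(0,1)$. View the symmetric algebra $\mathcal S(I)=\operatorname{Sym}_R(I)$ as a $B$-algebra by letting $y_i$ act as $fx_i\in I=\operatorname{Sym}_1(I)$ for $i\le n$ and $y_{n+1}$ as $g\in I=\operatorname{Sym}_1(I)$, with the bigrading induced from $B$. Then there are forms $\partial_1,\dots,\partial_n\in R$ of degree $d-1$ with $\sum_i x_i\partial_i=g$. For any such choice put $h=\sum_{i=1}^n\partial_i y_i-fy_{n+1}$, and let $E_\bullet$ be the Eagon–Northcott complex of $$\psi=\begin{bmatrix}x_1&\cdots&x_n\\ y_1&\cdots&y_n\end{bmatrix},\qquad E_0=B,\qquad E_i=\bigwedge\nolimits^{i+1}B^n\otimes(\operatorname{Sym}_{i-1}B^2)^*\ \ (i\ge 1).$$ Then the mapping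 cone $F_\bullet$ of multiplication by $h$, $E_\bullet(-d+1,-1)\xrightarrow{\ h\ }E_\bullet$, is, together with the natural map $F_0=B\to\mathcal S(I)$, a minimal bigraded free $B$-resolution of $\mathcal S(I)$. It has length exactly $n$, $0\to F_n\to\cdots\to F_1\to F_0$, and its modules are $$F_0=B,\qquad F_1=B(-d+1,-1)\oplus B^{\binom n2}(-1,-1),$$ $$F_i=\bigoplus_{a=0}^{i-2}B^{\binom ni}(-d-a,-i+a)\ \oplus\ \bigoplus_{a=0}^{i-1}B^{\binom n{i+1}}(-a-1,-i+a)\qquad(2\le i\le n).$$ In particular $F_n=\bigoplus_{a=0}^{n-2}B(-d-a,-n+a)$ has rank $n-1$. Moreover, $\mathcal S(I)$ is Cohen–Macaulay. -/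

import Mathlib

namespace DeJonquieres

open MvPolynomial

/-- The polynomial ring `R = k[x_1, …, x_n]`. -/
abbrev BaseRing (k : Type*) [Field k] (n : ℕ) := MvPolynomial (Fin n) k

/-- The polynomial ring `B = R[y_1, …, y_{n+1}]` over `R = k[x_1, …, x_n]`. -/
abbrev BigRing (k : Type*) [Field k] (n : ℕ) := MvPolynomial (Fin (n + 1)) (BaseRing k n)

section Ideal

variable {k : Type*} [Field k] {n : ℕ}

/-- The generators `f x_1, …, f x_n, g`. -/
noncomputable def gen (f g : BaseRing k n) : Fin (n + 1) → BaseRing k n :=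
  Fin.snoc (fun i : Fin n => f * X i) g

/-- The ideal `I = (f x_1, …, f x_n, g)` of `R`. -/
noncomputable def baseIdeal (f g : BaseRing k n) : Ideal (BaseRing k n) :=
  Ideal.span (Set.range (gen f g))

/-- The `R`-algebra map `B → Sym_R(I)` that sends `y_i` to the element `f x_i` of `I = Sym_1(I)`
for `i ≤ n`, and `y_{n+1}` to `g`. -/
noncomputable def symHom (f g : BaseRing k n) :
    BigRing k n →ₐ[BaseRing k n] SymmetricAlgebra (BaseRing k n) (baseIdeal f g) :=
  aeval fun j => SymmetricAlgebra.ι (BaseRing k n) (baseIdeal f g)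
    ⟨gen f g j, Ideal.subset_span ⟨j, rfl⟩⟩

/-- `Sym_R(I)` as a `B`-algebra (and hence as a `B`-module), through `symHom`. -/
noncomputable instance symAlgebra (f g : BaseRing k n) :
    Algebra (BigRing k n) (SymmetricAlgebra (BaseRing k n) (baseIdeal f g)) :=
  (symHom f g).toRingHom.toAlgebra

/-- The matrix `ψ` with rows `x_1, …, x_n` and `y_1, …, y_n`. -/
noncomputable def psi (k : Type*) [Field k] (n : ℕ) : Matrix (Fin 2) (Fin n) (BigRing k n) :=
  Matrix.of ![fun i => C (X i), fun i => X i.castSucc]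

/-- `∂g`: a column of forms of degree `d - 1` with `∑ x_i (∂g)_i = g`. -/
def IsPartialColumn (d : ℕ) (g : BaseRing k n) (dg : Fin n → BaseRing k n) : Prop :=
  (∀ i, (dg i).IsHomogeneous (d - 1)) ∧ ∑ i, X i * dg i = g

/-- `h = ∑ (∂g)_i y_i - f y_{n+1}`. -/
noncomputable def hPoly (f : BaseRing k n) (dg : Fin n → BaseRing k n) : BigRing k n :=
  ∑ i : Fin n, C (dg i) * X i.castSucc - C f * X (Fin.last n)

/-- The homogeneous maximal ideal `(x_1, …, x_n, y_1, …, y_{n+1})` of `B`. -/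
noncomputable def irrelevantIdeal (k : Type*) [Field k] (n : ℕ) : Ideal (BigRing k n) :=
  Ideal.span (Set.range (fun i : Fin n => (C (X i) : BigRing k n)) ∪
    Set.range (fun j : Fin (n + 1) => (X j : BigRing k n)))

end Ideal

section Bigrading

variable {k : Type*} [Field k] {n : ℕ}

/-- The bihomogeneous part `B_c` for `bideg x_i = (1,0)`, `bideg y_j = (0,1)`: the polynomials
all of whose monomials `x^s y^t` have `(|s|, |t|) = c`.  It is `0` if `c` has a negative entry. -/
def bipart (k : Type*) [Field k] (n : ℕ) (c : ℤ × ℤ) : AddSubgroup (BigRing k n) where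
  carrier := {b | ∀ (t : Fin (n + 1) →₀ ℕ) (s : Fin n →₀ ℕ),
    (b.coeff t).coeff s ≠ 0 → ((s.degree : ℤ), (t.degree : ℤ)) = c}
  zero_mem' := by
    intro t s hts
    simp at hts
  add_mem' := by
    intro a b ha hb t s hts
    by_cases h : (a.coeff t).coeff s = 0
    · refine hb t s fun h' => hts ?_
      rw [coeff_add, coeff_add, h, h', add_zero]
    · exact ha t s h
  neg_mem' := by
    intro a ha t s hts
    refine ha t s fun h' => hts ?_
    rw [coeff_neg, coeff_neg, h', neg_zero]

/-- The part of bidegree `c` of the bigraded free module `⨁_j B(-deg j)`. -/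
def freePart {ι : Type} (deg : ι → ℤ × ℤ) (c : ℤ × ℤ) : AddSubgroup (ι → BigRing k n) where
  carrier := {v | ∀ j, v j ∈ bipart k n (c - deg j)}
  zero_mem' := fun _ => zero_mem _
  add_mem' := fun ha hb j => add_mem (ha j) (hb j)
  neg_mem' := fun ha j => neg_mem (ha j)

/-- The family `gr` makes the `B`-module `M` a bigraded module. -/
structure IsBigrading (k : Type*) [Field k] (n : ℕ) {M : Type*} [AddCommGroup M] [Module (BigRing k n) M]
    (gr : ℤ × ℤ → AddSubgroup M) : Prop where
  isInternal : DirectSum.IsInternal gr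
  smul_mem : ∀ (c e : ℤ × ℤ) (b : BigRing k n) (m : M),
    b ∈ bipart k n c → m ∈ gr e → b • m ∈ gr (c + e)

/-- The bigrading of `Sym_R(I)` induced by that of `B`: the images of the parts `B_c`. -/
noncomputable def symPart (f g : BaseRing k n) (c : ℤ × ℤ) :
    AddSubgroup (SymmetricAlgebra (BaseRing k n) (baseIdeal f g)) :=
  (bipart k n c).map (algebraMap (BigRing k n)
    (SymmetricAlgebra (BaseRing k n) (baseIdeal f g)))

/-- `⋯ → F_2 → F_1 → F_0 → M → 0` is a minimal bigraded free resolution of the bigraded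
`B`-module `M`.  Here `F_i = ⨁_{j : ι i} B(-deg i j)`, the map `F_{i+1} → F_i` is given by the
matrix `D i`, and `ε : F_0 → M` is the augmentation. -/
structure IsMinimalBigradedFreeResolution {M : Type*} [AddCommGroup M] [Module (BigRing k n) M]
    (gr : ℤ × ℤ → AddSubgroup M) (ι : ℕ → Type) [∀ i, Fintype (ι i)]
    (deg : ∀ i, ι i → ℤ × ℤ) (D : ∀ i, Matrix (ι i) (ι (i + 1)) (BigRing k n))
    (ε : (ι 0 → BigRing k n) →ₗ[BigRing k n] M) : Prop where
  isBigrading : IsBigrading k n gr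
  surjective : Function.Surjective ε
  exact_zero : Function.Exact (D 0).mulVecLin ε
  exact_succ : ∀ i, Function.Exact (D (i + 1)).mulVecLin (D i).mulVecLin
  augmentation_mem : ∀ c v, v ∈ freePart (deg 0) c → ε v ∈ gr c
  differential_mem : ∀ i c v, v ∈ freePart (deg (i + 1)) c →
    (D i).mulVecLin v ∈ freePart (deg i) c
  minimal : ∀ i r s, D i r s ∈ irrelevantIdeal k n

end Bigrading

section EagonNorthcott

/-- Basis of the `i`-th module of the Eagon–Northcott complex of a `2 × n` matrix.  In degree `0`
it is one element.  In degree `i ≥ 1` the module is `Λ^{i+1}(A^n) ⊗ D_{i-1}(A^2)`, and the pair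
`(S, a)` stands for `e_S ⊗ u^{(a)} v^{(b)}`, `a + b = i - 1`, where `u^{(a)} v^{(b)}` is the basis
of divided monomials of `D_{i-1}(A^2) = Sym_{i-1}(A^2)^*`. -/
def ENIndex (n : ℕ) : ℕ → Type
  | 0 => Unit
  | i + 1 => {S : Finset (Fin n) // S.card = i + 2} × Fin (i + 1)

instance ENIndex.instFintype (n : ℕ) : ∀ i, Fintype (ENIndex n i)
  | 0 => inferInstanceAs (Fintype Unit)
  | i + 1 => inferInstanceAs (Fintype ({S : Finset (Fin n) // S.card = i + 2} × Fin (i + 1)))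

instance ENIndex.instDecidableEq (n : ℕ) : ∀ i, DecidableEq (ENIndex n i)
  | 0 => inferInstanceAs (DecidableEq Unit)
  | i + 1 => inferInstanceAs (DecidableEq ({S : Finset (Fin n) // S.card = i + 2} × Fin (i + 1)))

/-- The differentials of the Eagon–Northcott complex of a `2 × n` matrix `ψ` with rows `p`, `q`.
The first one sends `e_{s,t}`, `s < t`, to the minor `p_s q_t - p_t q_s`.  The later ones send
`e_S ⊗ u^{(a)} v^{(b)}`, `S = {s_0 < s_1 < ⋯}`, to
`∑_j (-1)^j e_{S \ s_j} ⊗ (p_{s_j} u^{(a-1)} v^{(b)} + q_{s_j} u^{(a)} v^{(b-1)})`,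
where terms with a negative exponent are zero. -/
def enD {A : Type*} [CommRing A] {n : ℕ} (ψ : Matrix (Fin 2) (Fin n) A) :
    ∀ i, Matrix (ENIndex n i) (ENIndex n (i + 1)) A
  | 0 => fun _ S => (ψ.submatrix id (S.1.1.orderEmbOfFin S.1.2)).det
  | i + 1 => fun T S => ∑ j : Fin (i + 3),
      if T.1.1 = S.1.1.erase (S.1.1.orderEmbOfFin S.1.2 j) then
        (-1) ^ (j : ℕ) *
          ((if (T.2 : ℕ) + 1 = S.2 then ψ 0 (S.1.1.orderEmbOfFin S.1.2 j) else 0) +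
            (if (T.2 : ℕ) = S.2 then ψ 1 (S.1.1.orderEmbOfFin S.1.2 j) else 0))
      else 0

/-- Bidegrees of the basis of the Eagon–Northcott complex, if the first row of the matrix has
bidegree `(1,0)` and the second one has bidegree `(0,1)`:
`e_S ⊗ u^{(a)} v^{(b)}` has bidegree `(a + 1, b + 1)`. -/
def enDeg (n : ℕ) : ∀ i, ENIndex n i → ℤ × ℤ
  | 0 => fun _ => (0, 0)
  | i + 1 => fun S => ((S.2 : ℤ) + 1, (i : ℤ) - (S.2 : ℤ) + 1)

/-- Basis of the mapping cone of an endomorphism of the Eagon–Northcott complex: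
`F_0 = EN_0` and `F_{i+1} = EN_i ⊕ EN_{i+1}`. -/
def ConeIndex (n : ℕ) : ℕ → Type
  | 0 => ENIndex n 0
  | i + 1 => ENIndex n i ⊕ ENIndex n (i + 1)

instance ConeIndex.instFintype (n : ℕ) : ∀ i, Fintype (ConeIndex n i)
  | 0 => inferInstanceAs (Fintype (ENIndex n 0))
  | i + 1 => inferInstanceAs (Fintype (ENIndex n i ⊕ ENIndex n (i + 1)))

/-- The differentials of the mapping cone of multiplication by `h` on the Eagon–Northcott complex
of `ψ`: `(u, v) ↦ h u + ∂ v` on `F_1`, and `(u, v) ↦ (-∂ u, h u + ∂ v)` on `F_i`, `i ≥ 2`. -/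
def coneD {A : Type*} [CommRing A] {n : ℕ} (ψ : Matrix (Fin 2) (Fin n) A) (h : A) :
    ∀ i, Matrix (ConeIndex n i) (ConeIndex n (i + 1)) A
  | 0 => Matrix.fromCols (Matrix.scalar (ENIndex n 0) h) (enD ψ 0)
  | i + 1 => Matrix.fromBlocks (-enD ψ i) 0 (Matrix.scalar (ENIndex n (i + 1)) h) (enD ψ (i + 1))

/-- Bidegrees of the basis of the mapping cone, if `h` has bidegree `(d - 1, 1)`. -/
def coneDeg (n d : ℕ) : ∀ i, ConeIndex n i → ℤ × ℤ
  | 0 => enDeg n 0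
  | i + 1 => Sum.elim (fun u => enDeg n i u + ((d : ℤ) - 1, 1)) (enDeg n (i + 1))

end EagonNorthcott

section Augmentation

variable {k : Type*} [Field k] {n : ℕ}

/-- The augmentation `F_0 = B → Sym_R(I)`. -/
noncomputable def coneAug (f g : BaseRing k n) :
    (ConeIndex n 0 → BigRing k n) →ₗ[BigRing k n]
      SymmetricAlgebra (BaseRing k n) (baseIdeal f g) :=
  (Algebra.linearMap (BigRing k n) (SymmetricAlgebra (BaseRing k n) (baseIdeal f g))).comp
    (LinearMap.proj (R := BigRing k n) (φ := fun _ : ConeIndex n 0 => BigRing k n) ())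

end Augmentation

section CohenMacaulay

/-- A Noetherian local ring is Cohen–Macaulay if its maximal ideal contains a regular sequence
whose length is the Krull dimension of the ring. -/
def IsCohenMacaulayLocal (A : Type*) [CommRing A] [IsLocalRing A] : Prop :=
  IsNoetherianRing A ∧ ∃ rs : List A, (∀ r ∈ rs, r ∈ IsLocalRing.maximalIdeal A) ∧
    RingTheory.Sequence.IsRegular A rs ∧ (rs.length : WithBot ℕ∞) = ringKrullDim A

/-- A Noetherian ring is Cohen–Macaulay if all its localizations at maximal ideals are. -/
def IsCohenMacaulay (A : Type*) [CommRing A] : Prop :=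
  IsNoetherianRing A ∧ ∀ (p : Ideal A) [p.IsMaximal],
    IsCohenMacaulayLocal (Localization.AtPrime p)

end CohenMacaulay

end DeJonquieres

/-!
The symmetric algebra of `I = (f x_1, …, f x_n, g)` is computed from the syzygies of its generators.
If `∑ a_i f x_i + b g = 0`, then `f` divides `b` because `f` and `g` are coprime; subtracting a
multiple of `(∂_1, …, ∂_n, -f)` leaves a syzygy of `x_1, …, x_n`, which is a combination of Koszul
syzygies.  So `Sym(I) = B / (I_2(ψ), h)`, where `I_2(ψ)` is the ideal of `2 × 2` minors of `ψ`
(`mem_symIdeal_of_symHom_eq_zero`).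

The minors are handled through toric maps: sending `y_j` to `λ x_j` for `j ≤ m` is a monomial map
whose kernel is generated by the minors of the first `m` columns
(`mem_minorIdeal_of_toricMap_eq_zero`).  In particular `I_2(ψ)` is prime, and `h ∉ I_2(ψ)` since
`f ≠ 0`; so the mapping cone of `h` resolves `Sym(I)` as soon as the Eagon–Northcott complex resolves
`B / I_2(ψ)` (`coneD_exact`).

The Eagon–Northcott complex of a matrix with rows `p`, `q` is assembled from the Koszul differentials
`∂_p` and `∂_q` on the exterior algebra of `B^n`: in positive degrees it is the total complex of a
truncated double complex, and its first map is `∂_q ∂_p`.  Its exactness follows from two facts, both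
proved by adding one column at a time: the Koszul complex of `p` is exact in positive degrees, and an
element of positive degree killed by `∂_p` and `∂_q` is in the image of `∂_p ∂_q`.  For the second
one, `IsGenericPair` is what the induction needs in its lowest degree, and the toric maps verify it
for the rows `x` and `y` (`enD_exact`, `isGenericPair_xRow_yRow`).  All maps are bihomogeneous with
entries in the irrelevant ideal, which gives the bigrading and minimality.

For the Cohen–Macaulay property, `A = B / I_2(ψ)` is free over the polynomial ring in the linear forms
`x_1, y_1 - x_2, …, y_{n-1} - x_n, y_n, y_{n+1}` with basis `1, x_2, …, x_n`
(`exists_algebra_toricRing_free`).  The element `h ≠ 0` of the domain `A` divides a nonzero polynomial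
`N` in the parameters, and a change of variables of Nagata makes `N` monic in one of them.
Then `A / h` is finite and flat over the polynomial ring `T` in the other ones: it is finite because
of the monic equation, and flat because `N`, hence `h`, is a nonzerodivisor modulo every ideal of `T`
(`flat_of_surjective_of_monic`).  A ring that is finite and flat over a polynomial ring over a field
is Cohen–Macaulay, because regular sequences in maximal ideals of the polynomial ring stay regular
(`isCohenMacaulay_of_finite_of_flat`).
-/

namespace DeJonquieres

open MvPolynomial

/-! ### Toric maps and the ideal of minors -/

section Toric

/-- The kernel of a monomial map is contained in every ideal that identifies monomials with the
same image. -/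
theorem mem_of_monomialMap_eq_zero {k τ υ : Type*} [CommRing k]
    (φ : MvPolynomial τ k →ₐ[k] MvPolynomial υ k) (W : (τ →₀ ℕ) → (υ →₀ ℕ))
    (hφ : ∀ e, φ (monomial e 1) = monomial (W e) 1) (I : Ideal (MvPolynomial τ k))
    (hI : ∀ e e', W e = W e' → (monomial e 1 - monomial e' 1 : MvPolynomial τ k) ∈ I)
    (b : MvPolynomial τ k) (hb : φ b = 0) : b ∈ I := by
  classical
  -- a linear section of `φ` modulo `I`
  let σ : MvPolynomial υ k →ₗ[k] MvPolynomial τ k ⧸ I := (basisMonomials υ k).constr k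
    fun e => if h : ∃ s, W s = e then Ideal.Quotient.mk I (monomial h.choose 1) else 0
  have hσ : σ ∘ₗ φ.toLinearMap = (Ideal.Quotient.mkₐ k I).toLinearMap := by
    refine (basisMonomials τ k).ext fun e => ?_
    have h : ∃ s, W s = W e := ⟨e, rfl⟩
    have : σ (monomial (W e) 1) = _ := (basisMonomials υ k).constr_basis k _ (W e)
    simp only [coe_basisMonomials, LinearMap.comp_apply, AlgHom.toLinearMap_apply, hφ, this]
    rw [dif_pos h]
    exact Ideal.Quotient.eq.2 (hI _ _ h.choose_spec)
  rw [← Ideal.Quotient.eq_zero_iff_mem]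
  have := LinearMap.congr_fun hσ b
  simpa [hb] using this.symm

/-- The ideal generated by the `2 × 2` minors of the first `m` columns of the matrix with rows
`p` and `q`. -/
def minorIdeal {A : Type*} [CommRing A] {n : ℕ} (p q : Fin n → A) (m : ℕ) : Ideal A :=
  Ideal.span {a | ∃ i j : Fin n, (i : ℕ) < m ∧ (j : ℕ) < m ∧ a = p i * q j - p j * q i}

variable {n : ℕ}

/-- The exponent of the image of a variable under the map that sends `y_j` to `λ x_j` for `j < m`
and fixes the other variables.  Here `λ` is the variable `none`, `x_i` the variable `inr i` and
`y_j` the variable `inl j`. -/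
noncomputable def toricWeight (m : ℕ) (hm : m ≤ n) :
    Fin (n + 1) ⊕ Fin n → (Option (Fin (n + 1) ⊕ Fin n) →₀ ℕ)
  | .inr i => Finsupp.single (some (.inr i)) 1
  | .inl j => if h : (j : ℕ) < m then
      Finsupp.single none 1 + Finsupp.single (some (.inr ⟨j, h.trans_le hm⟩)) 1
    else Finsupp.single (some (.inl j)) 1

/-- The exponent of the image of a monomial under the toric map of the first `m` columns. -/
noncomputable def toricExp (m : ℕ) (hm : m ≤ n) :
    (Fin (n + 1) ⊕ Fin n →₀ ℕ) →ₗ[ℕ] (Option (Fin (n + 1) ⊕ Fin n) →₀ ℕ) :=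
  Finsupp.linearCombination ℕ (toricWeight m hm)

theorem toricExp_apply (m : ℕ) (hm : m ≤ n) (e : Fin (n + 1) ⊕ Fin n →₀ ℕ)
    (c : Option (Fin (n + 1) ⊕ Fin n)) : toricExp m hm e c =
      (∑ j : Fin (n + 1), e (.inl j) * toricWeight m hm (.inl j) c) +
        ∑ i : Fin n, e (.inr i) * toricWeight m hm (.inr i) c := by
  rw [toricExp, Finsupp.linearCombination_apply, Finsupp.sum_fintype _ _ (by simp),
    Fintype.sum_sum_type]
  simp

theorem toricExp_none (m : ℕ) (hm : m ≤ n) (e : Fin (n + 1) ⊕ Fin n →₀ ℕ) :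
    toricExp m hm e none = ∑ j : Fin (n + 1), if (j : ℕ) < m then e (.inl j) else 0 := by
  rw [toricExp_apply]
  have : ∀ i : Fin n, toricWeight m hm (.inr i) none = 0 := fun i => by simp [toricWeight]
  simp only [this, mul_zero, Finset.sum_const_zero, add_zero]
  refine Finset.sum_congr rfl fun j _ => ?_
  by_cases h : (j : ℕ) < m <;> simp [toricWeight, h]

theorem toricExp_inl (m : ℕ) (hm : m ≤ n) (e : Fin (n + 1) ⊕ Fin n →₀ ℕ) (j : Fin (n + 1)) :
    toricExp m hm e (some (.inl j)) = if (j : ℕ) < m then 0 else e (.inl j) := by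
  rw [toricExp_apply]
  have : ∀ i : Fin n, toricWeight m hm (.inr i) (some (.inl j)) = 0 := fun i => by
    simp [toricWeight]
  simp only [this, mul_zero, Finset.sum_const_zero, add_zero]
  rw [Finset.sum_eq_single j]
  · by_cases h : (j : ℕ) < m <;> simp [toricWeight, h]
  · intro i _ hij
    by_cases h : (i : ℕ) < m <;> simp [toricWeight, h, hij]
  · simp

theorem toricExp_inr (m : ℕ) (hm : m ≤ n) (e : Fin (n + 1) ⊕ Fin n →₀ ℕ) (i : Fin n) :
    toricExp m hm e (some (.inr i)) =
      (if (i : ℕ) < m then e (.inl i.castSucc) else 0) + e (.inr i) := by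
  rw [toricExp_apply]
  congr 1
  · rw [Finset.sum_eq_single i.castSucc]
    · by_cases h : (i : ℕ) < m <;> simp [toricWeight, h]
    · intro j _ hij
      by_cases h : (j : ℕ) < m
      · have : (⟨j, h.trans_le hm⟩ : Fin n) ≠ i := fun h' => hij (by ext; simp [← h'])
        simp [toricWeight, h, this]
      · simp [toricWeight, h]
    · simp
  · rw [Finset.sum_eq_single i]
    · simp [toricWeight]
    · intro j _ hij
      simp [toricWeight, hij]
    · simp

/-- Two monomials with the same image under the toric map are congruent modulo the minors: swapping
`x_j y_i` for `x_i y_j` moves one closer to the other. -/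
theorem monomial_sub_monomial_mem_minorIdeal {k : Type*} [CommRing k] (m : ℕ) (hm : m ≤ n)
    (e' : Fin (n + 1) ⊕ Fin n →₀ ℕ) (N : ℕ) (e : Fin (n + 1) ⊕ Fin n →₀ ℕ)
    (hN : ∑ j : Fin (n + 1), (e (.inl j) - e' (.inl j)) = N)
    (he : toricExp m hm e = toricExp m hm e') :
    (monomial e 1 - monomial e' 1 : MvPolynomial (Fin (n + 1) ⊕ Fin n) k) ∈
      minorIdeal (fun i : Fin n => (X (.inr i) : MvPolynomial (Fin (n + 1) ⊕ Fin n) k))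
        (fun i => X (.inl i.castSucc)) m := by
  classical
  -- induction on the total excess of the exponents of the `y_j` over those of `e'`
  induction N generalizing e with
  | zero =>
    have hle : ∀ j, e (.inl j) ≤ e' (.inl j) := fun j => by
      have := Finset.sum_eq_zero_iff.1 hN j (Finset.mem_univ _)
      omega
    have hl : ∀ j, e (.inl j) = e' (.inl j) := by
      intro j
      by_cases hj : (j : ℕ) < m
      · have h0 := DFunLike.congr_fun he none
        rw [toricExp_none, toricExp_none] at h0
        have := (Finset.sum_eq_sum_iff_of_le (fun j _ => by
          split_ifs
          · exact hle j
          · exact le_rfl)).1 h0 j (Finset.mem_univ _)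
        simpa [hj] using this
      · have h0 := DFunLike.congr_fun he (some (.inl j))
        rw [toricExp_inl, toricExp_inl] at h0
        simpa [hj] using h0
    have : e = e' := by
      ext c
      rcases c with j | i
      · exact hl j
      · have h0 := DFunLike.congr_fun he (some (.inr i))
        rw [toricExp_inr, toricExp_inr, hl] at h0
        omega
    simp [this]
  | succ N ih =>
    have h0 := DFunLike.congr_fun he none
    rw [toricExp_none, toricExp_none] at h0
    have hge : ∀ j : Fin (n + 1), ¬ (j : ℕ) < m → e (.inl j) = e' (.inl j) := fun j hj => by
      have h0 := DFunLike.congr_fun he (some (.inl j))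
      rw [toricExp_inl, toricExp_inl] at h0
      simpa [hj] using h0
    obtain ⟨i, -, hi⟩ : ∃ i ∈ Finset.univ, e (.inl i) - e' (.inl i) ≠ 0 :=
      Finset.exists_ne_zero_of_sum_ne_zero (by omega)
    have him : (i : ℕ) < m := by
      by_contra h
      have := hge i h
      omega
    obtain ⟨j, hjm, hj⟩ : ∃ j : Fin (n + 1), (j : ℕ) < m ∧ e (.inl j) < e' (.inl j) := by
      by_contra! hcon
      have : ∑ j : Fin (n + 1), (if (j : ℕ) < m then e' (.inl j) else 0) <
          ∑ j : Fin (n + 1), if (j : ℕ) < m then e (.inl j) else 0 := by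
        refine Finset.sum_lt_sum (fun j _ => ?_) ⟨i, Finset.mem_univ _, ?_⟩
        · split_ifs with h
          · exact hcon j h
          · exact le_rfl
        · simp only [him, if_true]
          omega
      omega
    obtain ⟨i, rfl⟩ : ∃ i' : Fin n, i = i'.castSucc := ⟨⟨i, him.trans_le hm⟩, rfl⟩
    obtain ⟨j, rfl⟩ : ∃ j' : Fin n, j = j'.castSucc := ⟨⟨j, hjm.trans_le hm⟩, rfl⟩
    simp only [Fin.val_castSucc] at him hjm
    have hij : i ≠ j := by
      rintro rfl
      omega
    have hrj : e (.inr j) ≠ 0 := by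
      have h0 := DFunLike.congr_fun he (some (.inr j))
      rw [toricExp_inr, toricExp_inr] at h0
      simp only [hjm, if_true] at h0
      omega
    obtain ⟨e₀, he₀⟩ : ∃ e₀, e = e₀ + (Finsupp.single (.inl i.castSucc) 1 +
        Finsupp.single (.inr j) 1) := by
      refine ⟨e - (Finsupp.single (.inl i.castSucc) 1 + Finsupp.single (.inr j) 1), ?_⟩
      refine (tsub_add_cancel_of_le ?_).symm
      intro c
      rcases c with c | c
      · by_cases hc : i.castSucc = c
        · subst hc
          simp
          omega
        · simp [hc]
      · by_cases hc : j = c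
        · subst hc
          simp
          omega
        · simp [hc]
    -- `e₁` arises from `e` by replacing `y_i x_j` with `y_j x_i`
    set e₁ := e₀ + (Finsupp.single (.inl j.castSucc) 1 + Finsupp.single (.inr i) 1) with he₁
    have hW : toricExp m hm e₁ = toricExp m hm e := by
      rw [he₀, he₁, map_add, map_add]
      simp only [map_add, toricExp, Finsupp.linearCombination_single, toricWeight, one_smul,
        Fin.val_castSucc, him, hjm, dif_pos, Fin.eta]
      abel
    have hN' : ∑ c : Fin (n + 1), (e₁ (.inl c) - e' (.inl c)) = N := by
      have hc' : i.castSucc ≠ j.castSucc := fun h => hij (Fin.castSucc_injective _ h)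
      have : ∀ c : Fin (n + 1), e (.inl c) - e' (.inl c) =
          (e₁ (.inl c) - e' (.inl c)) + if c = i.castSucc then 1 else 0 := by
        intro c
        have e1 : e (.inl c) = e₀ (.inl c) + if c = i.castSucc then 1 else 0 := by
          simp [he₀, Finsupp.single_apply, eq_comm]
        have e2 : e₁ (.inl c) = e₀ (.inl c) + if c = j.castSucc then 1 else 0 := by
          simp [he₁, Finsupp.single_apply, eq_comm]
        by_cases h1 : c = i.castSucc
        · subst h1
          simp only [if_true, hc', if_false] at e1 e2 ⊢
          omega
        · by_cases h2 : c = j.castSucc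
          · subst h2
            simp only [if_true, h1, if_false] at e1 e2 ⊢
            omega
          · simp only [h1, h2, if_false] at e1 e2 ⊢
            omega
      rw [Finset.sum_congr rfl fun c _ => this c, Finset.sum_add_distrib] at hN
      simp only [Finset.sum_ite_eq', Finset.mem_univ, if_true] at hN
      omega
    have key := ih e₁ hN' (hW.trans he)
    have hsub : (monomial e 1 - monomial e₁ 1 : MvPolynomial (Fin (n + 1) ⊕ Fin n) k) ∈
        minorIdeal (fun i : Fin n => (X (.inr i) : MvPolynomial (Fin (n + 1) ⊕ Fin n) k))
        (fun i => X (.inl i.castSucc)) m := by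
      have : (monomial e 1 - monomial e₁ 1 : MvPolynomial (Fin (n + 1) ⊕ Fin n) k) =
          monomial e₀ 1 *
            (X (.inr j) * X (.inl i.castSucc) - X (.inr i) * X (.inl j.castSucc)) := by
        rw [he₀, he₁]
        simp only [X, mul_sub, monomial_mul, mul_one]
        rw [add_comm (Finsupp.single (Sum.inr j) 1), add_comm (Finsupp.single (Sum.inr i) 1)]
      rw [this]
      exact Ideal.mul_mem_left _ _ (Ideal.subset_span ⟨j, i, hjm, him, rfl⟩)
    have := add_mem hsub key
    simpa using this

variable (k : Type*) [Field k]

/-- The variables of `B` over `k`: `x_i` is `inr i` and `y_j` is `inl j`. -/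
noncomputable abbrev bigRingEquiv (n : ℕ) :
    MvPolynomial (Fin (n + 1) ⊕ Fin n) k ≃ₐ[k] BigRing k n :=
  sumAlgEquiv k (Fin (n + 1)) (Fin n)

/-- The `k`-algebra map on `B` that sends `y_j` to `λ x_j` for `j < m` and fixes the other
variables. -/
noncomputable def toricMap (m : ℕ) (hm : m ≤ n) :
    BigRing k n →ₐ[k] MvPolynomial (Option (Fin (n + 1) ⊕ Fin n)) k :=
  (aeval fun c => monomial (toricWeight m hm c) 1 :
    MvPolynomial (Fin (n + 1) ⊕ Fin n) k →ₐ[k] _).comp (bigRingEquiv k n).symm.toAlgHom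

/-- The row `x` of the matrix `ψ`. -/
noncomputable abbrev xRow (n : ℕ) : Fin n → BigRing k n := fun i => C (X i)

/-- The row `y` of the matrix `ψ`. -/
noncomputable abbrev yRow (n : ℕ) : Fin n → BigRing k n := fun i => X i.castSucc

theorem toricMap_x (m : ℕ) (hm : m ≤ n) (i : Fin n) :
    toricMap k m hm (C (X i)) = X (some (.inr i)) := by
  simp only [toricMap, AlgHom.comp_apply, AlgEquiv.toAlgHom_apply, sumAlgEquiv_symm_C_X, aeval_X]
  rfl

theorem toricMap_y_of_lt (m : ℕ) (hm : m ≤ n) (i : Fin n) (hi : (i : ℕ) < m) :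
    toricMap k m hm (X i.castSucc) = X none * X (some (.inr i)) := by
  simp only [toricMap, AlgHom.comp_apply, AlgEquiv.toAlgHom_apply, sumAlgEquiv_symm_X, aeval_X]
  simp [toricWeight, hi, X, monomial_mul]

theorem toricMap_y_of_le (m : ℕ) (hm : m ≤ n) (j : Fin (n + 1)) (hj : m ≤ j) :
    toricMap k m hm (X j) = X (some (.inl j)) := by
  simp only [toricMap, AlgHom.comp_apply, AlgEquiv.toAlgHom_apply, sumAlgEquiv_symm_X, aeval_X]
  simp [toricWeight, hj.not_gt, X]

/-- The kernel of the toric map of the first `m` columns is generated by their minors; for `m = n`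
this says that the maximal ideal of `R` is of linear type. -/
theorem mem_minorIdeal_of_toricMap_eq_zero (m : ℕ) (hm : m ≤ n) (b : BigRing k n)
    (hb : toricMap k m hm b = 0) : b ∈ minorIdeal (xRow k n) (yRow k n) m := by
  have h := mem_of_monomialMap_eq_zero (k := k)
    (aeval fun c => monomial (toricWeight m hm c) 1) (toricExp m hm) (fun e => by
      rw [aeval_monomial, map_one, one_mul, Finsupp.prod, toricExp,
        Finsupp.linearCombination_apply, Finsupp.sum, monomial_sum_one]
      simp [monomial_pow])
    (minorIdeal (fun i : Fin n => X (.inr i)) (fun i => X (.inl i.castSucc)) m)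
    (fun e e' he => monomial_sub_monomial_mem_minorIdeal m hm e' _ e rfl he)
    ((bigRingEquiv k n).symm b) hb
  have h' := Ideal.mem_map_of_mem (bigRingEquiv k n).toAlgHom.toRingHom h
  rw [minorIdeal, Ideal.map_span] at h'
  simp only [AlgHom.toRingHom_eq_coe, RingHom.coe_coe] at h'
  rw [show (bigRingEquiv k n).toAlgHom ((bigRingEquiv k n).symm b) = b from
    (bigRingEquiv k n).apply_symm_apply b] at h'
  refine Ideal.span_mono ?_ h'
  rintro _ ⟨_, ⟨i, j, hi, hj, rfl⟩, rfl⟩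
  refine ⟨i, j, hi, hj, ?_⟩
  simp [sumAlgEquiv_X_inl, sumAlgEquiv_X_inr]

end Toric

/-! ### Koszul differentials on the exterior algebra -/

section Exterior

variable {A : Type*} [CommRing A] {n : ℕ}

/-- The coefficient vectors of elements of the exterior algebra of `A^n`: `w T` is the coefficient
of `e_T`. -/
abbrev ExtCoeff (A : Type*) (n : ℕ) := Finset (Fin n) → A

/-- The sign `(-1)^#{t ∈ T | t < s}` with which `e_s ∧ e_T` is reordered. -/
def extSign (A : Type*) [CommRing A] (s : Fin n) (T : Finset (Fin n)) : A :=
  (-1) ^ (T.filter (· < s)).card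

theorem extSign_mul_self (s : Fin n) (T : Finset (Fin n)) :
    extSign A s T * extSign A s T = 1 := by
  rw [extSign, ← mul_pow]
  simp

theorem extSign_insert (s t : Fin n) (T : Finset (Fin n)) (hs : s ∉ T) :
    extSign A t (insert s T) = (if s < t then -1 else 1) * extSign A t T := by
  unfold extSign
  rw [Finset.filter_insert]
  split_ifs with h
  · rw [Finset.card_insert_of_notMem (by simp [hs]), pow_succ, mul_comm]
  · rw [one_mul]

theorem extSign_mul_insert (s t : Fin n) (T : Finset (Fin n)) (hst : s ≠ t) (hs : s ∉ T)
    (ht : t ∉ T) : extSign A s T * extSign A t (insert s T) =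
      -(extSign A t T * extSign A s (insert t T)) := by
  rw [extSign_insert s t T hs, extSign_insert t s T ht]
  rcases lt_or_gt_of_ne hst with h | h
  · simp only [h, h.not_gt, if_true, if_false]
    ring
  · simp only [h, h.not_gt, if_true, if_false]
    ring

/-- Contraction of the exterior algebra with the dual basis vector `e_s^*`. -/
def contractBasis (s : Fin n) : ExtCoeff A n →ₗ[A] ExtCoeff A n where
  toFun w T := if s ∈ T then 0 else extSign A s T * w (insert s T)
  map_add' v w := by
    ext T
    by_cases h : s ∈ T <;> simp [h, mul_add]
  map_smul' c w := by
    ext T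
    by_cases h : s ∈ T <;> simp [h, mul_left_comm]

/-- Left multiplication by `e_s` on the exterior algebra. -/
def wedgeBasis (s : Fin n) : ExtCoeff A n →ₗ[A] ExtCoeff A n where
  toFun w T := if s ∈ T then extSign A s (T.erase s) * w (T.erase s) else 0
  map_add' v w := by
    ext T
    by_cases h : s ∈ T <;> simp [h, mul_add]
  map_smul' c w := by
    ext T
    by_cases h : s ∈ T <;> simp [h, mul_left_comm]

theorem contractBasis_apply (s : Fin n) (w : ExtCoeff A n) (T : Finset (Fin n)) :
    contractBasis s w T = if s ∈ T then 0 else extSign A s T * w (insert s T) := rfl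

theorem wedgeBasis_apply (s : Fin n) (w : ExtCoeff A n) (T : Finset (Fin n)) :
    wedgeBasis s w T = if s ∈ T then extSign A s (T.erase s) * w (T.erase s) else 0 := rfl

theorem contractBasis_comm (s t : Fin n) (w : ExtCoeff A n) :
    contractBasis s (contractBasis t w) = -contractBasis t (contractBasis s w) := by
  ext T
  simp only [contractBasis_apply, Pi.neg_apply, Finset.mem_insert]
  by_cases hs : s ∈ T
  · simp [hs]
  by_cases ht : t ∈ T
  · simp [ht]
  by_cases hst : s = t
  · simp [hst]
  simp only [hs, ht, hst, Ne.symm hst, or_self, if_false]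
  rw [← mul_assoc, ← mul_assoc, extSign_mul_insert s t T hst hs ht, Finset.insert_comm]
  ring

theorem contractBasis_self (s : Fin n) (w : ExtCoeff A n) :
    contractBasis s (contractBasis s w) = 0 := by
  ext T
  simp [contractBasis_apply]

theorem contractBasis_wedgeBasis (s t : Fin n) (w : ExtCoeff A n) :
    contractBasis s (wedgeBasis t w) =
      (if s = t then w else 0) - wedgeBasis t (contractBasis s w) := by
  ext T
  by_cases hst : s = t
  · subst hst
    simp only [contractBasis_apply, wedgeBasis_apply, Pi.sub_apply, if_true]
    by_cases hs : s ∈ T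
    · simp [hs, ← mul_assoc, extSign_mul_self, Finset.insert_erase hs]
    · simp [hs, ← mul_assoc, extSign_mul_self, Finset.erase_insert hs]
  · simp only [contractBasis_apply, wedgeBasis_apply, Pi.sub_apply, hst, if_false, Pi.zero_apply,
      zero_sub, Finset.mem_insert, Ne.symm hst, false_or, Finset.mem_erase]
    by_cases hs : s ∈ T
    · simp [hs, hst]
    by_cases ht : t ∈ T
    · have hne : (insert s T).erase t = insert s (T.erase t) :=
        Finset.erase_insert_of_ne hst
      obtain ⟨U, hU, rfl⟩ : ∃ U, t ∉ U ∧ T = insert t U :=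
        ⟨T.erase t, Finset.notMem_erase _ _, (Finset.insert_erase ht).symm⟩
      have hsU : s ∉ U := fun h => hs (Finset.mem_insert_of_mem h)
      simp only [hs, Finset.mem_insert_self, if_true, if_false, hne, and_false,
        Finset.erase_insert hU, ← mul_assoc]
      rw [extSign_insert t s U hU, extSign_insert s t U hsU]
      rcases lt_or_gt_of_ne hst with h | h
      · simp only [h, h.not_gt, if_true, if_false]
        ring
      · simp only [h, h.not_gt, if_true, if_false]
        ring
    · simp [hs, ht]

/-- The Koszul differential of the sequence `p`: contraction with `∑ p_s e_s^*`. -/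
def koszul (p : Fin n → A) : ExtCoeff A n →ₗ[A] ExtCoeff A n := ∑ s, p s • contractBasis s

theorem koszul_apply (p : Fin n → A) (w : ExtCoeff A n) :
    koszul p w = ∑ s, p s • contractBasis s w := by
  simp [koszul]

theorem contractBasis_koszul (s : Fin n) (p : Fin n → A) (w : ExtCoeff A n) :
    contractBasis s (koszul p w) = -koszul p (contractBasis s w) := by
  simp only [koszul_apply, map_sum, map_smul, ← Finset.sum_neg_distrib]
  exact Finset.sum_congr rfl fun t _ => by rw [contractBasis_comm, smul_neg]

theorem koszul_koszul_comm (p q : Fin n → A) (w : ExtCoeff A n) :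
    koszul p (koszul q w) = -koszul q (koszul p w) := by
  rw [koszul_apply p, koszul_apply p, map_sum, ← Finset.sum_neg_distrib]
  exact Finset.sum_congr rfl fun s _ => by rw [contractBasis_koszul, map_smul, smul_neg]

theorem koszul_koszul_self (p : Fin n → A) (w : ExtCoeff A n) : koszul p (koszul p w) = 0 := by
  simp only [koszul_apply, map_sum, map_smul, Finset.smul_sum]
  rw [← Finset.sum_product']
  refine Finset.sum_involution (fun x _ => (x.2, x.1)) ?_ ?_ (by simp) (by simp)
  · rintro ⟨s, t⟩ -
    simp only
    rw [contractBasis_comm s t, smul_comm (p s)]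
    simp
  · rintro ⟨s, t⟩ - h h'
    simp only [Prod.mk.injEq] at h'
    refine h ?_
    simp [h'.1, contractBasis_self]

theorem koszul_wedgeBasis (p : Fin n → A) (t : Fin n) (w : ExtCoeff A n) :
    koszul p (wedgeBasis t w) = p t • w - wedgeBasis t (koszul p w) := by
  simp only [koszul_apply, map_sum, map_smul, contractBasis_wedgeBasis, smul_sub,
    Finset.sum_sub_distrib]
  simp

/-- The part of degree `j` of the exterior algebra on the first `m` basis vectors. -/
def extPart (A : Type*) [CommRing A] (n m j : ℕ) : Submodule A (ExtCoeff A n) where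
  carrier := {w | ∀ T, w T ≠ 0 → T.card = j ∧ ∀ t ∈ T, (t : ℕ) < m}
  zero_mem' := fun T h => absurd rfl h
  add_mem' := by
    intro v w hv hw T h
    by_cases hvT : v T = 0
    · exact hw T (by simpa [hvT] using h)
    · exact hv T hvT
  smul_mem' := by
    intro c w hw T h
    refine hw T fun h' => h ?_
    simp [h']

theorem extPart_mono {m m' j : ℕ} (h : m ≤ m') : extPart A n m j ≤ extPart A n m' j :=
  fun _ hw T hT => ⟨(hw T hT).1, fun t ht => ((hw T hT).2 t ht).trans_le h⟩

theorem contractBasis_mem {m j : ℕ} (s : Fin n) {w : ExtCoeff A n}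
    (hw : w ∈ extPart A n m (j + 1)) : contractBasis s w ∈ extPart A n m j := by
  intro T hT
  rw [contractBasis_apply] at hT
  split_ifs at hT with hs
  · exact absurd rfl hT
  · obtain ⟨h1, h2⟩ := hw _ (right_ne_zero_of_mul hT)
    rw [Finset.card_insert_of_notMem hs] at h1
    exact ⟨by omega, fun t ht => h2 t (Finset.mem_insert_of_mem ht)⟩

theorem contractBasis_last_mem {j : ℕ} (s : Fin n) {w : ExtCoeff A n}
    (hw : w ∈ extPart A n (s + 1) (j + 1)) : contractBasis s w ∈ extPart A n s j := by
  intro T hT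
  obtain ⟨h1, h2⟩ := contractBasis_mem s hw T hT
  refine ⟨h1, fun t ht => ?_⟩
  have hts : t ≠ s := by
    rintro rfl
    simp [contractBasis_apply, ht] at hT
  have := h2 t ht
  have : (t : ℕ) ≠ s := fun h => hts (Fin.ext h)
  omega

theorem contractBasis_eq_zero {m j : ℕ} (s : Fin n) (hs : m ≤ s) {w : ExtCoeff A n}
    (hw : w ∈ extPart A n m j) : contractBasis s w = 0 := by
  ext T
  rw [contractBasis_apply]
  split_ifs with h
  · rfl
  · by_cases h' : w (insert s T) = 0
    · simp [h']
    · have := (hw _ h').2 s (Finset.mem_insert_self _ _)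
      omega

theorem koszul_mem {m j : ℕ} (p : Fin n → A) {w : ExtCoeff A n}
    (hw : w ∈ extPart A n m (j + 1)) : koszul p w ∈ extPart A n m j := by
  rw [koszul_apply]
  exact Submodule.sum_mem _ fun s _ => Submodule.smul_mem _ _ (contractBasis_mem s hw)

theorem wedgeBasis_mem {m j : ℕ} (s : Fin n) (hs : (s : ℕ) < m) {w : ExtCoeff A n}
    (hw : w ∈ extPart A n m j) : wedgeBasis s w ∈ extPart A n m (j + 1) := by
  intro T hT
  rw [wedgeBasis_apply] at hT
  split_ifs at hT with h
  · obtain ⟨h1, h2⟩ := hw _ (right_ne_zero_of_mul hT)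
    rw [Finset.card_erase_of_mem h] at h1
    have := Finset.card_pos.2 ⟨s, h⟩
    refine ⟨by omega, fun t ht => ?_⟩
    by_cases hts : t = s
    · rwa [hts]
    · exact h2 t (Finset.mem_erase.2 ⟨hts, ht⟩)
  · exact absurd rfl hT

theorem sub_wedgeBasis_contractBasis_mem {j : ℕ} (s : Fin n) {w : ExtCoeff A n}
    (hw : w ∈ extPart A n (s + 1) j) :
    w - wedgeBasis s (contractBasis s w) ∈ extPart A n s j := by
  intro T hT
  have hsT : s ∉ T := by
    intro h
    apply hT
    simp [wedgeBasis_apply, contractBasis_apply, h, ← mul_assoc, extSign_mul_self,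
      Finset.insert_erase h]
  simp only [Pi.sub_apply, wedgeBasis_apply, hsT, if_false, sub_zero] at hT
  obtain ⟨h1, h2⟩ := hw T hT
  refine ⟨h1, fun t ht => ?_⟩
  have := h2 t ht
  have : (t : ℕ) ≠ s := fun h => hsT (Fin.ext h ▸ ht)
  omega

theorem eq_zero_of_mem_extPart_zero {j : ℕ} {w : ExtCoeff A n} (hw : w ∈ extPart A n 0 (j + 1)) :
    w = 0 := by
  ext T
  by_contra h
  obtain ⟨h1, h2⟩ := hw T h
  obtain ⟨t, ht⟩ := Finset.card_pos.1 (by omega : 0 < T.card)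
  exact absurd (h2 t ht) (by omega)

/-- The unit of the exterior algebra. -/
def extOne (A : Type*) [CommRing A] (n : ℕ) : ExtCoeff A n := fun T => if T = ∅ then 1 else 0

theorem eq_smul_extOne {m : ℕ} {w : ExtCoeff A n} (hw : w ∈ extPart A n m 0) :
    w = w ∅ • extOne A n := by
  ext T
  by_cases h : T = ∅
  · simp [h, extOne]
  · have : w T = 0 := by
      by_contra h'
      exact h (Finset.card_eq_zero.1 (hw T h').1)
    simp [h, extOne, this]

theorem extOne_mem (m : ℕ) : extOne A n ∈ extPart A n m 0 := by
  intro T hT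
  have : T = ∅ := by
    by_contra h
    simp [extOne, h] at hT
  simp [this]

theorem koszul_extOne (p : Fin n → A) : koszul p (extOne A n) = 0 := by
  rw [koszul_apply]
  refine Finset.sum_eq_zero fun s _ => ?_
  ext T
  simp [contractBasis_apply, extOne]

/-- The first `m` entries of a sequence, followed by zeros. -/
def truncRow (p : Fin n → A) (m : ℕ) : Fin n → A := fun i => if (i : ℕ) < m then p i else 0

theorem koszul_truncRow_succ (p : Fin n → A) (s : Fin n) (w : ExtCoeff A n) :
    koszul (truncRow p (s + 1)) w = koszul (truncRow p s) w + p s • contractBasis s w := by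
  have : ∀ i, truncRow p (s + 1) i = truncRow p s i + if i = s then p s else 0 := by
    intro i
    by_cases h : i = s
    · simp [h, truncRow]
    · have h' : (i : ℕ) ≠ s := fun h' => h (Fin.ext h')
      simp only [truncRow, h, if_false, add_zero]
      congr 1
      simp only [eq_iff_iff]
      omega
  simp only [koszul_apply, this, add_smul, Finset.sum_add_distrib]
  simp

theorem koszul_truncRow_succ_of_mem (p : Fin n → A) (s : Fin n) {w : ExtCoeff A n} {j : ℕ}
    (hw : w ∈ extPart A n s j) : koszul (truncRow p (s + 1)) w = koszul (truncRow p s) w := by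
  rw [koszul_truncRow_succ, contractBasis_eq_zero s le_rfl hw, smul_zero, add_zero]

theorem koszul_truncRow_wedgeBasis (p : Fin n → A) (s : Fin n) (w : ExtCoeff A n) :
    koszul (truncRow p s) (wedgeBasis s w) = -wedgeBasis s (koszul (truncRow p s) w) := by
  rw [koszul_wedgeBasis]
  simp [truncRow]

theorem koszul_truncRow_succ_wedgeBasis (p : Fin n → A) (s : Fin n) {w : ExtCoeff A n} {j : ℕ}
    (hw : w ∈ extPart A n s j) : koszul (truncRow p (s + 1)) (wedgeBasis s w) =
      p s • w - wedgeBasis s (koszul (truncRow p s) w) := by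
  rw [koszul_wedgeBasis, koszul_truncRow_succ_of_mem p s hw]
  simp [truncRow]

theorem koszul_truncRow_self (p : Fin n → A) : truncRow p n = p := by
  ext i
  simp [truncRow]

/-- If `α + e_s ∧ β` is a cycle for the first `s + 1` entries, with `α` and `β` in the exterior
algebra on the first `s` vectors, then `β` is a cycle for the first `s` entries. -/
theorem koszul_contractBasis_eq_zero (p : Fin n → A) (s : Fin n) {w : ExtCoeff A n}
    (h : koszul (truncRow p (s + 1)) w = 0) :
    koszul (truncRow p s) (contractBasis s w) = 0 := by
  have h1 := contractBasis_koszul s (truncRow p (s + 1)) w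
  rw [h, map_zero, koszul_truncRow_succ, contractBasis_self, smul_zero, add_zero] at h1
  exact neg_eq_zero.1 h1.symm

/-- If `α + e_s ∧ β` is a cycle for the first `s + 1` entries, with `α` and `β` in the exterior
algebra on the first `s` vectors, then `∂ α = - p_s β`. -/
theorem koszul_sub_add_eq_zero (p : Fin n → A) (s : Fin n) {w : ExtCoeff A n}
    (h : koszul (truncRow p (s + 1)) w = 0) :
    koszul (truncRow p s) (w - wedgeBasis s (contractBasis s w)) + p s • contractBasis s w = 0 := by
  rw [map_sub, koszul_truncRow_wedgeBasis, koszul_contractBasis_eq_zero p s h, map_zero, neg_zero,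
    sub_zero, ← koszul_truncRow_succ, h]

theorem exists_koszul_eq_smul_extOne (p : Fin n → A) (m : ℕ) {b : A}
    (hb : b ∈ Ideal.span {a | ∃ i : Fin n, (i : ℕ) < m ∧ a = p i}) :
    ∃ v ∈ extPart A n m 1, koszul (truncRow p m) v = b • extOne A n := by
  induction hb using Submodule.span_induction with
  | mem x hx =>
    obtain ⟨i, hi, rfl⟩ := hx
    refine ⟨wedgeBasis i (extOne A n), wedgeBasis_mem i hi (extOne_mem m), ?_⟩
    rw [koszul_wedgeBasis, koszul_extOne, map_zero, sub_zero]
    simp [truncRow, hi]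
  | zero => exact ⟨0, zero_mem _, by simp⟩
  | add x y _ _ hx hy =>
    obtain ⟨v, hv, h1⟩ := hx
    obtain ⟨w, hw, h2⟩ := hy
    exact ⟨v + w, add_mem hv hw, by rw [map_add, h1, h2, add_smul]⟩
  | smul c x _ hx =>
    obtain ⟨v, hv, h1⟩ := hx
    exact ⟨c • v, Submodule.smul_mem _ _ hv, by rw [map_smul, h1, smul_assoc]⟩

theorem exists_koszul_koszul_eq_smul_extOne (p q : Fin n → A) (m : ℕ) {b : A}
    (hb : b ∈ minorIdeal p q m) :
    ∃ v ∈ extPart A n m 2,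
      koszul (truncRow p m) (koszul (truncRow q m) v) = b • extOne A n := by
  induction hb using Submodule.span_induction with
  | mem x hx =>
    obtain ⟨i, j, hi, hj, rfl⟩ := hx
    refine ⟨wedgeBasis j (wedgeBasis i (extOne A n)),
      wedgeBasis_mem j hj (wedgeBasis_mem i hi (extOne_mem m)), ?_⟩
    simp only [koszul_wedgeBasis, koszul_extOne, map_zero, sub_zero, map_sub, map_smul]
    simp only [truncRow, hi, hj, if_true, smul_smul, ← sub_smul]
    congr 1
    ring
  | zero => exact ⟨0, zero_mem _, by simp⟩
  | add x y _ _ hx hy =>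
    obtain ⟨v, hv, h1⟩ := hx
    obtain ⟨w, hw, h2⟩ := hy
    exact ⟨v + w, add_mem hv hw, by rw [map_add, map_add, h1, h2, add_smul]⟩
  | smul c x _ hx =>
    obtain ⟨v, hv, h1⟩ := hx
    exact ⟨c • v, Submodule.smul_mem _ _ hv, by rw [map_smul, map_smul, h1, smul_assoc]⟩

theorem koszul_apply_empty (p : Fin n → A) (w : ExtCoeff A n) :
    koszul p w ∅ = ∑ s, p s * w {s} := by
  simp [koszul_apply, contractBasis_apply, extSign]

/-- `p` is a regular sequence (without the condition that it generates a proper ideal). -/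
def IsRegularRow (p : Fin n → A) : Prop :=
  ∀ (s : Fin n) (b : A), p s * b ∈ Ideal.span {a | ∃ i : Fin n, i < s ∧ a = p i} →
    b ∈ Ideal.span {a | ∃ i : Fin n, i < s ∧ a = p i}

/-- The condition on a `2 × n` matrix that makes its Eagon–Northcott complex exact: if a multiple
by `b` of a column is a linear combination of the previous columns, then `b` is in the ideal of
minors of the previous columns. -/
def IsGenericPair (p q : Fin n → A) : Prop :=
  ∀ (s : Fin n) (b : A) (c : Fin n → A), b * p s = ∑ i, c i * truncRow p s i →
    b * q s = ∑ i, c i * truncRow q s i → b ∈ minorIdeal p q s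

/-- The Koszul complex of a regular sequence is exact in positive degrees. -/
theorem exists_koszul_eq (p : Fin n → A) (hp : IsRegularRow p) (m : ℕ) (hm : m ≤ n) (j : ℕ)
    (w : ExtCoeff A n) (hw : w ∈ extPart A n m (j + 1)) (h : koszul (truncRow p m) w = 0) :
    ∃ v ∈ extPart A n m (j + 2), koszul (truncRow p m) v = w := by
  induction m generalizing j w with
  | zero => exact ⟨0, zero_mem _, by rw [map_zero, eq_zero_of_mem_extPart_zero hw]⟩
  | succ m ih =>
    obtain ⟨s, rfl⟩ : ∃ s : Fin n, m = s := ⟨⟨m, hm⟩, rfl⟩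
    have hβ := contractBasis_last_mem s hw
    have hα := sub_wedgeBasis_contractBasis_mem s hw
    have h1 := koszul_contractBasis_eq_zero p s h
    have h2 := koszul_sub_add_eq_zero p s h
    set β := contractBasis s w
    set α := w - wedgeBasis s β with hαdef
    -- `w = α + e_s ∧ β`, and `β` is a boundary: by induction, or by regularity in degree `0`
    obtain ⟨γ, hγ, hγβ⟩ : ∃ γ ∈ extPart A n s (j + 1), koszul (truncRow p s) γ = β := by
      rcases j with _ | j
      · rw [eq_smul_extOne hβ]
        refine exists_koszul_eq_smul_extOne p s (hp s _ ?_)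
        have h3 := congr_fun h2 ∅
        rw [Pi.add_apply, koszul_apply_empty] at h3
        simp only [Pi.smul_apply, smul_eq_mul, Pi.zero_apply] at h3
        rw [eq_neg_of_add_eq_zero_right h3]
        refine neg_mem (Submodule.sum_mem _ fun i _ => ?_)
        by_cases hi : (i : ℕ) < s
        · simp only [truncRow, hi, if_true]
          exact Ideal.mul_mem_right _ _ (Ideal.subset_span ⟨i, hi, rfl⟩)
        · simp [truncRow, hi]
      · exact ih (by omega) j β hβ h1
    obtain ⟨α', hα', h4⟩ := ih (by omega) j (α + p s • γ)
      (add_mem hα (Submodule.smul_mem _ _ hγ)) (by rw [map_add, map_smul, hγβ, h2])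
    refine ⟨α' - wedgeBasis s γ, sub_mem (extPart_mono (by omega) hα')
      (wedgeBasis_mem s (by omega) (extPart_mono (by omega) hγ)), ?_⟩
    rw [map_sub, koszul_truncRow_succ_of_mem p s hα', h4, koszul_truncRow_succ_wedgeBasis p s hγ,
      hγβ, hαdef]
    abel

/-- In positive degrees, the elements killed by the Koszul differentials of both rows are the images
of the composite of the two differentials. -/
theorem exists_koszul_koszul_eq (p q : Fin n → A) (hpq : IsGenericPair p q) (m : ℕ) (hm : m ≤ n)
    (j : ℕ) (w : ExtCoeff A n) (hw : w ∈ extPart A n m (j + 1))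
    (hp : koszul (truncRow p m) w = 0) (hq : koszul (truncRow q m) w = 0) :
    ∃ v ∈ extPart A n m (j + 3), koszul (truncRow p m) (koszul (truncRow q m) v) = w := by
  induction m generalizing j w with
  | zero => exact ⟨0, zero_mem _, by rw [map_zero, map_zero, eq_zero_of_mem_extPart_zero hw]⟩
  | succ m ih =>
    obtain ⟨s, rfl⟩ : ∃ s : Fin n, m = s := ⟨⟨m, hm⟩, rfl⟩
    have hβ := contractBasis_last_mem s hw
    have hα := sub_wedgeBasis_contractBasis_mem s hw
    have hp1 := koszul_contractBasis_eq_zero p s hp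
    have hp2 := koszul_sub_add_eq_zero p s hp
    have hq1 := koszul_contractBasis_eq_zero q s hq
    have hq2 := koszul_sub_add_eq_zero q s hq
    set β := contractBasis s w
    set α := w - wedgeBasis s β with hαdef
    -- `w = α + e_s ∧ β`, and `β = ∂_p ∂_q γ`: by induction, or by genericity in degree `0`
    obtain ⟨γ, hγ, hγβ⟩ : ∃ γ ∈ extPart A n s (j + 2),
        koszul (truncRow p s) (koszul (truncRow q s) γ) = β := by
      rcases j with _ | j
      · rw [eq_smul_extOne hβ]
        have key : ∀ r : Fin n → A, koszul (truncRow r s) α + r s • β = 0 →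
            β ∅ * r s = ∑ i, (-α {i}) * truncRow r s i := by
          intro r hr
          have h3 := congr_fun hr ∅
          rw [Pi.add_apply, koszul_apply_empty] at h3
          simp only [Pi.smul_apply, smul_eq_mul, Pi.zero_apply] at h3
          rw [mul_comm, eq_neg_of_add_eq_zero_right h3, ← Finset.sum_neg_distrib]
          exact Finset.sum_congr rfl fun i _ => by ring
        exact exists_koszul_koszul_eq_smul_extOne p q s (hpq s _ _ (key p hp2) (key q hq2))
      · exact ih (by omega) j β hβ hp1 hq1
    have hqγ : koszul (truncRow q s) γ ∈ extPart A n s (j + 1) := koszul_mem _ hγ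
    have hpγ : koszul (truncRow p s) γ ∈ extPart A n s (j + 1) := koszul_mem _ hγ
    have hDD : koszul (truncRow p (s + 1)) (koszul (truncRow q (s + 1)) (wedgeBasis s γ)) =
        q s • koszul (truncRow p s) γ - p s • koszul (truncRow q s) γ + wedgeBasis s β := by
      rw [koszul_truncRow_succ_wedgeBasis q s hγ, map_sub, map_smul,
        koszul_truncRow_succ_of_mem p s hγ, koszul_truncRow_succ_wedgeBasis p s hqγ, hγβ]
      abel
    -- subtracting `∂_p ∂_q (e_s ∧ γ)` from `w` removes the vector `e_s`
    have hα' : w - koszul (truncRow p (s + 1)) (koszul (truncRow q (s + 1)) (wedgeBasis s γ)) ∈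
        extPart A n s (j + 1) := by
      rw [hDD]
      have : w - (q s • koszul (truncRow p s) γ - p s • koszul (truncRow q s) γ +
          wedgeBasis s β) = α - q s • koszul (truncRow p s) γ + p s • koszul (truncRow q s) γ := by
        rw [hαdef]
        abel
      rw [this]
      exact add_mem (sub_mem hα (Submodule.smul_mem _ _ hpγ)) (Submodule.smul_mem _ _ hqγ)
    obtain ⟨δ, hδ, h4⟩ := ih (by omega) j _ hα'
      (by rw [← koszul_truncRow_succ_of_mem p s hα', map_sub, hp, koszul_koszul_self, sub_zero])
      (by rw [← koszul_truncRow_succ_of_mem q s hα', map_sub, hq,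
        koszul_koszul_comm (truncRow q _) (truncRow p _), koszul_koszul_self, map_zero, neg_zero,
        sub_zero])
    refine ⟨δ + wedgeBasis s γ, add_mem (extPart_mono (by omega) hδ)
      (wedgeBasis_mem s (by omega) (extPart_mono (by omega) hγ)), ?_⟩
    rw [map_add, map_add, koszul_truncRow_succ_of_mem q s hδ,
      koszul_truncRow_succ_of_mem p s (koszul_mem _ hδ), h4]
    abel

/-- Exactness of the total complex of the truncated Koszul double complex.  Here `w a` is the
component at `u^{(a)} v^{(i-1-a)}` of an element in degree `i`. -/
theorem exists_total_eq (p q : Fin n → A) (hreg : IsRegularRow p) (hpq : IsGenericPair p q)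
    (i : ℕ) (w : ℕ → ExtCoeff A n) (hw : ∀ a, w a ∈ extPart A n n (i + 2))
    (h0 : i = 0 → koszul q (koszul p (w 0)) = 0)
    (h : ∀ a < i, koszul p (w (a + 1)) + koszul q (w a) = 0) :
    ∃ v : ℕ → ExtCoeff A n, (∀ a, v a ∈ extPart A n n (i + 3)) ∧
      ∀ a < i + 1, koszul p (v (a + 1)) + koszul q (v a) = w a := by
  have hker : koszul q (koszul p (w 0)) = 0 := by
    rcases i with _ | i
    · exact h0 rfl
    · rw [koszul_koszul_comm, eq_neg_of_add_eq_zero_right (h 0 (by omega)), map_neg,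
        koszul_koszul_self, neg_zero, neg_zero]
  have hK := exists_koszul_eq p hreg n le_rfl (i + 1)
  have hDD := exists_koszul_koszul_eq p q hpq n le_rfl i (koszul p (w 0)) (koszul_mem p (hw 0))
  simp only [koszul_truncRow_self] at hK hDD
  obtain ⟨v₀, hv₀, hv₀w⟩ := hDD (koszul_koszul_self _ _) hker
  -- the components of `v` are found one after the other, starting from `v₀`
  have step : ∀ r ≤ i + 1, ∃ v : ℕ → ExtCoeff A n, (∀ a, v a ∈ extPart A n n (i + 3)) ∧
      (∀ a < r, koszul p (v (a + 1)) + koszul q (v a) = w a) ∧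
      (r < i + 1 → koszul p (w r - koszul q (v r)) = 0) := by
    intro r
    induction r with
    | zero =>
      refine fun _ => ⟨fun _ => v₀, fun _ => hv₀, fun a ha => absurd ha (by omega), fun _ => ?_⟩
      rw [map_sub, hv₀w, sub_self]
    | succ r ih =>
      intro hr
      obtain ⟨v, hv, h1, h2⟩ := ih (by omega)
      obtain ⟨u, hu, h3⟩ := hK _ (sub_mem (hw r) (koszul_mem q (hv r))) (h2 (by omega))
      refine ⟨Function.update v (r + 1) u, fun a => ?_, fun a ha => ?_, fun hr' => ?_⟩
      · by_cases ha : a = r + 1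
        · subst ha
          simpa using hu
        · simpa [ha] using hv a
      · rw [Function.update_of_ne (by omega : a ≠ r + 1)]
        by_cases har : a = r
        · subst har
          rw [Function.update_self, h3]
          abel
        · rw [Function.update_of_ne (by omega), h1 a (by omega)]
      · rw [Function.update_self, map_sub, koszul_koszul_comm p q, h3, map_sub,
          koszul_koszul_self, sub_zero, sub_neg_eq_add]
        exact h r (by omega)
  obtain ⟨v, hv, h1, -⟩ := step (i + 1) le_rfl
  exact ⟨v, hv, h1⟩

end Exterior

/-! ### Exactness of the Eagon–Northcott complex and of the mapping cone -/

section Matrices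

variable {A : Type*} [CommRing A] {n : ℕ}

theorem extSign_orderEmbOfFin {c : ℕ} (S : Finset (Fin n)) (hS : S.card = c) (j : Fin c) :
    extSign A (S.orderEmbOfFin hS j) (S.erase (S.orderEmbOfFin hS j)) = (-1) ^ (j : ℕ) := by
  rw [extSign]
  congr 1
  have : (S.erase (S.orderEmbOfFin hS j)).filter (· < S.orderEmbOfFin hS j) =
      (Finset.Iio j).map (S.orderEmbOfFin hS).toEmbedding := by
    ext t
    simp only [Finset.mem_filter, Finset.mem_erase, Finset.mem_map, Finset.mem_Iio,
      RelEmbedding.coe_toEmbedding]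
    constructor
    · rintro ⟨⟨_, ht⟩, hlt⟩
      obtain ⟨i, rfl⟩ : t ∈ Set.range (S.orderEmbOfFin hS) := by
        rw [Finset.range_orderEmbOfFin]
        exact ht
      exact ⟨i, (S.orderEmbOfFin hS).lt_iff_lt.1 hlt, rfl⟩
    · rintro ⟨i, hi, rfl⟩
      have := (S.orderEmbOfFin hS).lt_iff_lt.2 hi
      exact ⟨⟨this.ne, Finset.orderEmbOfFin_mem S hS i⟩, this⟩
  rw [this, Finset.card_map, Fin.card_Iio]

theorem sum_orderEmbOfFin {c : ℕ} (S : Finset (Fin n)) (hS : S.card = c) (F : Fin n → A) :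
    ∑ j, F (S.orderEmbOfFin hS j) = ∑ s ∈ S, F s := by
  rw [← Finset.sum_coe_sort S F]
  exact Fintype.sum_equiv (S.orderIsoOfFin hS).toEquiv _ _ fun j => rfl

/-- The terms of an Eagon–Northcott differential at `e_T` are indexed by the elements outside
`T`. -/
theorem sum_erase_eq {c : ℕ} (T : Finset (Fin n)) (hT : T.card = c)
    (G : Finset (Fin n) → Fin n → A) :
    ∑ S : {S : Finset (Fin n) // S.card = c + 1}, ∑ j : Fin (c + 1),
      (if T = S.1.erase (S.1.orderEmbOfFin S.2 j) then
        (-1) ^ (j : ℕ) * G S.1 (S.1.orderEmbOfFin S.2 j) else 0) =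
    ∑ s, if s ∈ T then 0 else extSign A s T * G (insert s T) s := by
  have h1 : ∀ S : {S : Finset (Fin n) // S.card = c + 1}, ∑ j : Fin (c + 1),
      (if T = S.1.erase (S.1.orderEmbOfFin S.2 j) then
        (-1) ^ (j : ℕ) * G S.1 (S.1.orderEmbOfFin S.2 j) else 0) =
      ∑ s, if s ∉ T ∧ S.1 = insert s T then extSign A s T * G (insert s T) s else 0 := by
    intro S
    have : ∀ j : Fin (c + 1), (if T = S.1.erase (S.1.orderEmbOfFin S.2 j) then
        (-1) ^ (j : ℕ) * G S.1 (S.1.orderEmbOfFin S.2 j) else 0) =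
        (fun s => if T = S.1.erase s then extSign A s T * G S.1 s else 0)
          (S.1.orderEmbOfFin S.2 j) := by
      intro j
      simp only
      split_ifs with h
      · rw [← extSign_orderEmbOfFin (A := A) S.1 S.2 j, ← h]
      · rfl
    rw [Finset.sum_congr rfl fun j _ => this j,
      sum_orderEmbOfFin S.1 S.2 fun s => if T = S.1.erase s then extSign A s T * G S.1 s else 0,
      ← Finset.sum_filter, ← Finset.sum_filter]
    have hS : {s ∈ S.1 | T = S.1.erase s} =
        Finset.univ.filter fun s => s ∉ T ∧ S.1 = insert s T := by
      ext s
      simp only [Finset.mem_filter, Finset.mem_univ, true_and]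
      constructor
      · rintro ⟨hs, rfl⟩
        exact ⟨Finset.notMem_erase _ _, (Finset.insert_erase hs).symm⟩
      · rintro ⟨hs, h⟩
        rw [h]
        exact ⟨Finset.mem_insert_self _ _, (Finset.erase_insert hs).symm⟩
    rw [hS]
    refine Finset.sum_congr rfl fun s hs => ?_
    rw [(Finset.mem_filter.1 hs).2.2]
  rw [Finset.sum_congr rfl fun S _ => h1 S, Finset.sum_comm]
  refine Finset.sum_congr rfl fun s _ => ?_
  by_cases hs : s ∈ T
  · simp [hs]
  · simp only [hs, not_false_eq_true, true_and, if_false]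
    rw [Finset.sum_eq_single ⟨insert s T, by rw [Finset.card_insert_of_notMem hs, hT]⟩]
    · simp
    · intro S _ hS
      rw [if_neg fun h => hS (Subtype.ext h)]
    · simp

/-- The basis element of the Eagon–Northcott complex in degree `0`. -/
def ENIndex.zero (n : ℕ) : ENIndex n 0 := ()

/-- The basis element `e_T ⊗ u^{(a)} v^{(i-a)}` of the Eagon–Northcott complex in degree
`i + 1`. -/
def ENIndex.mk {i : ℕ} (T : Finset (Fin n)) (hT : T.card = i + 2) (a : ℕ) (ha : a < i + 1) :
    ENIndex n (i + 1) := (⟨T, hT⟩, ⟨a, ha⟩)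

/-- An element of the Eagon–Northcott complex in positive degree as a family of elements of the
exterior algebra, indexed by the exponent of `u`. -/
def toFamily {i : ℕ} (x : ENIndex n (i + 1) → A) (a : ℕ) : ExtCoeff A n := fun T =>
  if h : T.card = i + 2 ∧ a < i + 1 then x (.mk T h.1 a h.2) else 0

/-- The inverse of `toFamily`. -/
def ofFamily (i : ℕ) (w : ℕ → ExtCoeff A n) : ENIndex n (i + 1) → A := fun S => w S.2 S.1.1

theorem toFamily_mem {i : ℕ} (x : ENIndex n (i + 1) → A) (a : ℕ) :
    toFamily x a ∈ extPart A n n (i + 2) := by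
  intro T hT
  by_cases h : T.card = i + 2 ∧ a < i + 1
  · exact ⟨h.1, fun t _ => t.2⟩
  · exact absurd (dif_neg h) hT

theorem toFamily_ofFamily {i : ℕ} (w : ℕ → ExtCoeff A n) {a : ℕ}
    (hw : w a ∈ extPart A n n (i + 2)) (ha : a < i + 1) :
    toFamily (ofFamily i w) a = w a := by
  ext T
  by_cases h : T.card = i + 2
  · simp [toFamily, ofFamily, ENIndex.mk, h, ha]
  · have : w a T = 0 := by
      by_contra h'
      exact h (hw T h').1
    simp [toFamily, h, this]

theorem toFamily_injective {i : ℕ} {x y : ENIndex n (i + 1) → A}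
    (h : ∀ a < i + 1, toFamily x a = toFamily y a) : x = y := by
  funext S
  have := congr_fun (h S.2 S.2.2) S.1.1
  simp only [toFamily, S.1.2, S.2.2, and_self, dif_pos] at this
  exact this

theorem toFamily_zero {i : ℕ} (a : ℕ) : toFamily (0 : ENIndex n (i + 1) → A) a = 0 := by
  ext T
  simp [toFamily]

theorem toFamily_apply {i : ℕ} (x : ENIndex n (i + 1) → A) {a : ℕ} (ha : a < i + 1)
    {T : Finset (Fin n)} (hT : T.card = i + 2) :
    toFamily x a T = x (.mk T hT a ha) := by
  simp [toFamily, hT, ha]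

/-- The higher Eagon–Northcott differentials are `∂_p + ∂_q` on families. -/
theorem enD_succ_mulVec (ψ : Matrix (Fin 2) (Fin n) A) (i : ℕ) (x : ENIndex n (i + 2) → A)
    (T : ENIndex n (i + 1)) : (enD ψ (i + 1)).mulVec x T =
      koszul (ψ 0) (toFamily x (T.2 + 1)) T.1.1 + koszul (ψ 1) (toFamily x T.2) T.1.1 := by
  obtain ⟨⟨T, hT⟩, a⟩ := T
  have hG := sum_erase_eq T hT fun S s => ψ 0 s * toFamily x (a + 1) S + ψ 1 s * toFamily x a S
  have hl : (enD ψ (i + 1)).mulVec x (⟨T, hT⟩, a) =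
      ∑ S : {S : Finset (Fin n) // S.card = i + 3}, ∑ j : Fin (i + 3),
      (if T = S.1.erase (S.1.orderEmbOfFin S.2 j) then
        (-1) ^ (j : ℕ) * (ψ 0 (S.1.orderEmbOfFin S.2 j) * toFamily x (a + 1) S.1 +
          ψ 1 (S.1.orderEmbOfFin S.2 j) * toFamily x a S.1) else 0) := by
    simp only [Matrix.mulVec, dotProduct]
    refine (Fintype.sum_prod_type' (f := fun (S : {S : Finset (Fin n) // S.card = i + 3})
      (b : Fin (i + 2)) => enD ψ (i + 1) (⟨T, hT⟩, a) (S, b) * x (S, b))).trans ?_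
    refine Finset.sum_congr rfl fun S _ => ?_
    simp only [enD, Finset.sum_mul]
    rw [Finset.sum_comm]
    refine Finset.sum_congr rfl fun j _ => ?_
    by_cases hj : T = S.1.erase (S.1.orderEmbOfFin S.2 j)
    · simp only [← hj, if_true, mul_assoc, ← Finset.mul_sum]
      congr 1
      simp only [add_mul, Finset.sum_add_distrib]
      have hb : ∀ c : ℕ, c < i + 2 → ∀ r : A,
          ∑ b : Fin (i + 2), (if c = (b : ℕ) then r else 0) * x (S, b) =
            r * toFamily x c S.1 := by
        intro c hc r
        rw [Finset.sum_eq_single ⟨c, hc⟩]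
        · rw [toFamily_apply x hc S.2, if_pos rfl]
          rfl
        · intro b _ hb
          rw [if_neg fun h => hb (Fin.ext h.symm), zero_mul]
        · simp
      exact congrArg₂ (· + ·) (hb (a + 1) (by omega) (ψ 0 (S.1.orderEmbOfFin S.2 j)))
        (hb a (by omega) (ψ 1 (S.1.orderEmbOfFin S.2 j)))
    · simp only [hj, if_false, zero_mul, Finset.sum_const_zero]
  rw [hl, hG]
  simp only [koszul_apply, Finset.sum_apply, Pi.smul_apply, contractBasis_apply, smul_eq_mul,
    ← Finset.sum_add_distrib]
  refine Finset.sum_congr rfl fun s _ => ?_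
  split_ifs
  · simp
  · ring

theorem toFamily_enD {i : ℕ} (ψ : Matrix (Fin 2) (Fin n) A) (x : ENIndex n (i + 2) → A) {a : ℕ}
    (ha : a < i + 1) : toFamily ((enD ψ (i + 1)).mulVec x) a =
      koszul (ψ 0) (toFamily x (a + 1)) + koszul (ψ 1) (toFamily x a) := by
  have hmem : koszul (ψ 0) (toFamily x (a + 1)) + koszul (ψ 1) (toFamily x a) ∈
      extPart A n n (i + 2) :=
    add_mem (koszul_mem _ (toFamily_mem x _)) (koszul_mem _ (toFamily_mem x _))
  ext T
  by_cases hT : T.card = i + 2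
  · rw [toFamily_apply _ ha hT, enD_succ_mulVec]
    rfl
  · have h0 : ∀ {w : ExtCoeff A n}, w ∈ extPart A n n (i + 2) → w T = 0 := fun hw => by
      by_contra h'
      exact hT (hw T h').1
    rw [h0 hmem, h0 (toFamily_mem _ _)]

/-- The first Eagon–Northcott differential is `∂_q ∂_p`. -/
theorem enD_zero_mulVec (ψ : Matrix (Fin 2) (Fin n) A) (x : ENIndex n 1 → A) :
    (enD ψ 0).mulVec x (.zero n) = koszul (ψ 1) (koszul (ψ 0) (toFamily x 0)) ∅ := by
  rw [koszul_apply_empty]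
  have h1 : ∀ s, koszul (ψ 0) (toFamily x 0) {s} =
      ∑ S : {S : Finset (Fin n) // S.card = 1 + 1}, ∑ j : Fin 2,
        if {s} = S.1.erase (S.1.orderEmbOfFin S.2 j) then
          (-1) ^ (j : ℕ) * (ψ 0 (S.1.orderEmbOfFin S.2 j) * toFamily x 0 S.1) else 0 := by
    intro s
    rw [sum_erase_eq {s} (Finset.card_singleton s) fun S t => ψ 0 t * toFamily x 0 S]
    simp only [koszul_apply, Finset.sum_apply, Pi.smul_apply, contractBasis_apply, smul_eq_mul]
    refine Finset.sum_congr rfl fun t _ => ?_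
    split_ifs
    · simp
    · ring
  have h2 : ∀ (S : {S : Finset (Fin n) // S.card = 1 + 1}) (s : Fin n) (j : Fin 2),
      {s} = S.1.erase (S.1.orderEmbOfFin S.2 j) ↔ S.1.orderEmbOfFin S.2 (1 - j) = s := by
    intro S s j
    have hne : S.1.orderEmbOfFin S.2 (1 - j) ≠ S.1.orderEmbOfFin S.2 j := by
      rw [Ne, EmbeddingLike.apply_eq_iff_eq]
      fin_cases j <;> simp
    have : {S.1.orderEmbOfFin S.2 (1 - j)} = S.1.erase (S.1.orderEmbOfFin S.2 j) := by
      refine Finset.eq_of_subset_of_card_le ?_ ?_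
      · rw [Finset.singleton_subset_iff, Finset.mem_erase]
        exact ⟨hne, Finset.orderEmbOfFin_mem _ _ _⟩
      · rw [Finset.card_erase_of_mem (Finset.orderEmbOfFin_mem _ _ _), S.2,
          Finset.card_singleton]
    rw [← this, Finset.singleton_inj, eq_comm]
  simp only [h1, h2, Finset.mul_sum]
  rw [Finset.sum_comm]
  refine (Fintype.sum_prod_type' (f := fun (S : {S : Finset (Fin n) // S.card = 2})
    (b : Fin 1) => enD ψ 0 (.zero n) (S, b) * x (S, b))).trans ?_
  refine Finset.sum_congr rfl fun S _ => ?_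
  rw [Finset.sum_comm, Fin.sum_univ_two, Fin.sum_univ_one]
  simp only [mul_ite, mul_zero, Finset.sum_ite_eq, Finset.mem_univ, if_true]
  change (ψ.submatrix id (S.1.orderEmbOfFin S.2)).det * x (S, 0) = _
  have hx : toFamily x 0 S.1 = x (S, 0) := toFamily_apply x (by omega) S.2
  rw [Matrix.det_fin_two, hx]
  simp only [Matrix.submatrix_apply, id, sub_zero, sub_self, Fin.val_zero, Fin.val_one, pow_zero,
    pow_one]
  ring

theorem koszul_koszul_eq_smul_extOne (p q : Fin n → A) {w : ExtCoeff A n}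
    (hw : w ∈ extPart A n n 2) :
    koszul q (koszul p w) = koszul q (koszul p w) ∅ • extOne A n :=
  eq_smul_extOne (koszul_mem _ (koszul_mem _ hw))

/-- The Eagon–Northcott complex of a generic pair of rows is exact in positive degrees. -/
theorem enD_exact (ψ : Matrix (Fin 2) (Fin n) A) (hreg : IsRegularRow (ψ 0))
    (hpq : IsGenericPair (ψ 0) (ψ 1)) (i : ℕ) :
    Function.Exact (enD ψ (i + 1)).mulVecLin (enD ψ i).mulVecLin := by
  intro x
  simp only [Matrix.mulVecLin_apply, Set.mem_range]
  constructor
  · intro hx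
    have h0 : i = 0 → koszul (ψ 1) (koszul (ψ 0) (toFamily x 0)) = 0 := by
      rintro rfl
      have := congr_fun hx (.zero n)
      rw [enD_zero_mulVec] at this
      rw [koszul_koszul_eq_smul_extOne _ _ (toFamily_mem x 0), this, Pi.zero_apply, zero_smul]
    have h : ∀ a < i,
        koszul (ψ 0) (toFamily x (a + 1)) + koszul (ψ 1) (toFamily x a) = 0 := by
      intro a ha
      obtain ⟨i, rfl⟩ : ∃ i', i = i' + 1 := ⟨i - 1, by omega⟩
      rw [← toFamily_enD ψ x ha, hx, toFamily_zero]
    obtain ⟨v, hv, hvx⟩ := exists_total_eq (ψ 0) (ψ 1) hreg hpq i (toFamily x) (toFamily_mem x)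
      h0 h
    refine ⟨ofFamily (i + 1) v, toFamily_injective fun a ha => ?_⟩
    rw [toFamily_enD ψ _ ha, toFamily_ofFamily v (hv _) (by omega),
      toFamily_ofFamily v (hv _) (by omega), hvx a ha]
  · rintro ⟨y, rfl⟩
    rcases i with _ | i
    · funext u
      obtain rfl : u = .zero n := rfl
      rw [enD_zero_mulVec, toFamily_enD ψ y (by omega), map_add, koszul_koszul_self, zero_add,
        koszul_koszul_comm, koszul_koszul_self, map_zero, neg_zero, Pi.zero_apply, Pi.zero_apply]
    · refine toFamily_injective fun a ha => ?_
      rw [toFamily_enD ψ _ ha, toFamily_enD ψ y (by omega), toFamily_enD ψ y (by omega), map_add,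
        map_add, koszul_koszul_self, koszul_koszul_self, koszul_koszul_comm (ψ 1) (ψ 0),
        toFamily_zero]
      abel

/-- The image of the first Eagon–Northcott differential is the ideal of maximal minors. -/
theorem mem_minorIdeal_iff (ψ : Matrix (Fin 2) (Fin n) A) (b : A) :
    b ∈ minorIdeal (ψ 0) (ψ 1) n ↔ ∃ x, (enD ψ 0).mulVec x (.zero n) = b := by
  constructor
  · intro hb
    obtain ⟨v, hv, h⟩ := exists_koszul_koszul_eq_smul_extOne (ψ 0) (ψ 1) n hb
    rw [koszul_truncRow_self, koszul_truncRow_self] at h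
    refine ⟨ofFamily 0 fun _ => -v, ?_⟩
    rw [enD_zero_mulVec, toFamily_ofFamily _ (neg_mem hv) (by omega), map_neg, map_neg,
      koszul_koszul_comm, h]
    simp [extOne]
  · rintro ⟨x, rfl⟩
    refine Submodule.sum_mem _ fun S _ => Ideal.mul_mem_right _ _ ?_
    change (ψ.submatrix id (S.1.1.orderEmbOfFin S.1.2)).det ∈ _
    rw [Matrix.det_fin_two]
    refine Ideal.subset_span ⟨S.1.1.orderEmbOfFin S.1.2 0, S.1.1.orderEmbOfFin S.1.2 1,
      Fin.is_lt _, Fin.is_lt _, ?_⟩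
    simp only [Matrix.submatrix_apply, id]

/-- The vector `(u, v)` of the mapping cone. -/
def coneVec {i : ℕ} (u : ENIndex n i → A) (v : ENIndex n (i + 1) → A) :
    ConeIndex n (i + 1) → A := Sum.elim u v

/-- The mapping cone of multiplication by `h` is exact in positive degrees if the Eagon–Northcott
complex is and `h` is a nonzerodivisor modulo the minors. -/
theorem coneD_exact (ψ : Matrix (Fin 2) (Fin n) A) (h : A)
    (hE : ∀ i, Function.Exact (enD ψ (i + 1)).mulVecLin (enD ψ i).mulVecLin)
    (hh : ∀ u, h * u ∈ minorIdeal (ψ 0) (ψ 1) n → u ∈ minorIdeal (ψ 0) (ψ 1) n) (i : ℕ) :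
    Function.Exact (coneD ψ h (i + 1)).mulVecLin (coneD ψ h i).mulVecLin := by
  have hsc : ∀ (j : ℕ) (v : ENIndex n j → A),
      (Matrix.scalar (ENIndex n j) h).mulVec v = h • v := by
    intro j v
    ext
    simp [Matrix.scalar_apply, Matrix.mulVec_diagonal]
  have hcomp : ∀ j y, (enD ψ j).mulVec ((enD ψ (j + 1)).mulVec y) = 0 := fun j y =>
    (hE j ((enD ψ (j + 1)).mulVec y)).2 ⟨y, rfl⟩
  have hD0 : ∀ u v, (coneD ψ h 0).mulVec (coneVec u v) = h • u + (enD ψ 0).mulVec v := by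
    intro u v
    rw [← hsc]
    exact Matrix.fromCols_mulVec_sumElim _ _ _ _
  have hDs : ∀ j u v, (coneD ψ h (j + 1)).mulVec (coneVec u v) =
      coneVec (-(enD ψ j).mulVec u) (h • u + (enD ψ (j + 1)).mulVec v) := by
    intro j u v
    rw [← hsc]
    refine (Matrix.fromBlocks_mulVec _ _ _ _ _).trans ?_
    congr 1
    simp [Matrix.neg_mulVec]
    rfl
  have hu : ∀ (u : ENIndex n i → A) (v : ENIndex n (i + 1) → A),
      h • u + (enD ψ i).mulVec v = 0 →
      (∃ y, (enD ψ i).mulVec y = u) →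
      coneVec u v ∈ Set.range (coneD ψ h (i + 1)).mulVecLin := by
    rintro u v h2 ⟨y, rfl⟩
    -- `h u + ∂ v = ∂ (v + h y)`, so `v + h y` is a boundary `∂ z`
    have : (enD ψ i).mulVec (v + h • y) = 0 := by
      rw [Matrix.mulVec_add, Matrix.mulVec_smul, add_comm, h2]
    obtain ⟨z, hz⟩ := (hE i _).1 this
    refine ⟨coneVec (-y) z, ?_⟩
    rw [Matrix.mulVecLin_apply] at hz ⊢
    rw [hDs, hz, Matrix.mulVec_neg]
    congr 1
    · simp
    · simp
  have hsplit : ∀ x : ConeIndex n (i + 1) → A, ∃ (u : ENIndex n i → A)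
      (v : ENIndex n (i + 1) → A), x = coneVec u v :=
    fun x => ⟨fun s => x (Sum.inl s), fun s => x (Sum.inr s), by
      funext s
      rcases s with s | s <;> rfl⟩
  intro x
  obtain ⟨u, v, rfl⟩ := hsplit x
  constructor
  · intro hx
    rw [Matrix.mulVecLin_apply] at hx
    rcases i with _ | i
    · rw [hD0] at hx
      refine hu u v hx ?_
      have h1 : h * u (.zero n) ∈ minorIdeal (ψ 0) (ψ 1) n := by
        refine (mem_minorIdeal_iff ψ _).2 ⟨-v, ?_⟩
        have := congr_fun hx (.zero n)
        simp only [Pi.add_apply, Pi.smul_apply, smul_eq_mul] at this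
        rw [Matrix.mulVec_neg, Pi.neg_apply, eq_neg_of_add_eq_zero_left this]
      obtain ⟨y, hy⟩ := (mem_minorIdeal_iff ψ _).1 (hh _ h1)
      exact ⟨y, funext fun _ => hy⟩
    · rw [hDs] at hx
      have h1 : (enD ψ i).mulVec u = 0 := by
        refine neg_eq_zero.1 (funext fun s => ?_)
        exact congr_fun hx (Sum.inl s)
      have h2 : h • u + (enD ψ (i + 1)).mulVec v = 0 := by
        funext s
        exact congr_fun hx (Sum.inr s)
      exact hu u v h2 ((hE i u).1 h1)
  · rintro ⟨y, hy⟩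
    obtain ⟨u', v', rfl⟩ : ∃ (u' : ENIndex n (i + 1) → A) (v' : ENIndex n (i + 2) → A),
        y = coneVec u' v' := ⟨fun s => y (Sum.inl s), fun s => y (Sum.inr s), by
      funext s
      rcases s with s | s <;> rfl⟩
    rw [Matrix.mulVecLin_apply] at hy ⊢
    rw [← hy, hDs]
    rcases i with _ | i
    · rw [hD0, Matrix.mulVec_add, hcomp, Matrix.mulVec_smul]
      simp
      rfl
    · rw [hDs, Matrix.mulVec_add, hcomp, Matrix.mulVec_smul, Matrix.mulVec_neg, hcomp]
      funext s
      rcases s with s | s <;> simp <;> rfl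

end Matrices

/-! ### The generic matrix of the variables -/

section Generic

variable (k : Type*) [Field k] {n : ℕ}

/-- The variables `x_1, …, x_n` form a regular sequence in `B`. -/
theorem isRegularRow_xRow : IsRegularRow (xRow k n) := by
  intro s b hb
  have hspan : Ideal.span {a | ∃ i : Fin n, i < s ∧ a = xRow k n i} =
      Ideal.map C (Ideal.span (X '' {i : Fin n | i < s} : Set (BaseRing k n))) := by
    rw [Ideal.map_span]
    congr 1
    ext a
    constructor
    · rintro ⟨i, hi, rfl⟩
      exact ⟨X i, ⟨i, hi, rfl⟩, rfl⟩
    · rintro ⟨_, ⟨i, hi, rfl⟩, rfl⟩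
      exact ⟨i, hi, rfl⟩
  rw [hspan, mem_map_C_iff] at hb ⊢
  intro m
  have h1 := hb m
  rw [coeff_C_mul] at h1
  rw [mem_ideal_span_X_image] at h1 ⊢
  intro e he
  rw [support_X_mul] at h1
  obtain ⟨i, hi, h2⟩ := h1 (Finsupp.single s 1 + e) (Finset.mem_map_of_mem _ he)
  refine ⟨i, hi, ?_⟩
  have : s ≠ i := (ne_of_gt hi)
  simpa [Finsupp.single_apply, this] using h2

theorem toricMap_eq_zero_of_mem (m : ℕ) (hm : m ≤ n) {b : BigRing k n}
    (hb : b ∈ minorIdeal (xRow k n) (yRow k n) m) : toricMap k m hm b = 0 := by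
  have : minorIdeal (xRow k n) (yRow k n) m ≤ RingHom.ker (toricMap k m hm) := by
    refine Ideal.span_le.2 ?_
    rintro _ ⟨i, j, hi, hj, rfl⟩
    simp only [SetLike.mem_coe, RingHom.mem_ker, map_sub, map_mul, xRow, yRow, toricMap_x,
      toricMap_y_of_lt k m hm i hi, toricMap_y_of_lt k m hm j hj]
    ring
  exact this hb

/-- Under the toric map of the first `s` columns, a relation that expresses `b` times the column
`s` through the previous ones becomes `b (y_s - λ x_s) = 0`. -/
theorem isGenericPair_xRow_yRow : IsGenericPair (xRow k n) (yRow k n) := by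
  intro s b c hx hy
  refine mem_minorIdeal_of_toricMap_eq_zero k s s.2.le b ?_
  set φ := toricMap k (s : ℕ) s.2.le with hφ
  have hs : φ (yRow k n s) = X (some (.inl s.castSucc)) :=
    toricMap_y_of_le k s s.2.le s.castSucc le_rfl
  have hx' := congr_arg φ hx
  have hy' := congr_arg φ hy
  have hc : ∑ i, φ (c i) * φ (truncRow (yRow k n) s i) =
      X none * ∑ i, φ (c i) * φ (truncRow (xRow k n) s i) := by
    rw [Finset.mul_sum]
    refine Finset.sum_congr rfl fun i _ => ?_
    by_cases hi : (i : ℕ) < s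
    · simp only [truncRow, hi, if_true, yRow, xRow, hφ, toricMap_y_of_lt k s s.2.le i hi,
        toricMap_x]
      ring
    · simp [truncRow, hi]
  simp only [map_mul, map_sum, hs] at hx' hy'
  rw [hc, ← hx', hφ, toricMap_x, ← hφ, ← sub_eq_zero] at hy'
  have : φ b * (X (some (.inl s.castSucc)) - X none * X (some (.inr s))) = 0 := by
    rw [← hy']
    ring
  refine (mul_eq_zero.1 this).resolve_right fun h0 => ?_
  have := congr_arg (aeval (R := k) fun c : Option (Fin (n + 1) ⊕ Fin n) =>
    if c = some (.inl s.castSucc) then (1 : k) else 0) h0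
  simp at this

variable {k}

theorem toricMap_hPoly_ne_zero {f : BaseRing k n} (hf : f ≠ 0) (dg : Fin n → BaseRing k n) :
    toricMap k n le_rfl (hPoly f dg) ≠ 0 := by
  -- the specialization `λ = 0`, `y = 1` sends `h` to `-f`
  let ev : MvPolynomial (Option (Fin (n + 1) ⊕ Fin n)) k →ₐ[k] BaseRing k n :=
    aeval fun c => c.elim 0 (Sum.elim (fun _ => 1) X)
  have hev : (ev.comp (toricMap k n le_rfl)).comp
      (IsScalarTower.toAlgHom k (BaseRing k n) (BigRing k n)) = AlgHom.id k _ := by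
    ext i
    simp [ev, toricMap_x, algebraMap_eq]
  have hC : ∀ r : BaseRing k n, ev (toricMap k n le_rfl (C r)) = r := fun r =>
    DFunLike.congr_fun hev r
  intro h
  have h' := congr_arg ev h
  simp only [hPoly, map_sub, map_sum, map_mul, hC, map_zero] at h'
  rw [toricMap_y_of_le k n le_rfl (Fin.last n) (by simp)] at h'
  simp only [toricMap_y_of_lt k n le_rfl _ (Fin.is_lt _)] at h'
  simp [ev] at h'
  exact hf h'

/-- `h` is a nonzerodivisor modulo the minors, since these generate the kernel of a map to a domain
that does not kill `h`. -/
theorem mem_minorIdeal_of_hPoly_mul_mem {f : BaseRing k n} (hf : f ≠ 0)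
    (dg : Fin n → BaseRing k n) (u : BigRing k n)
    (hu : hPoly f dg * u ∈ minorIdeal (xRow k n) (yRow k n) n) :
    u ∈ minorIdeal (xRow k n) (yRow k n) n := by
  have := toricMap_eq_zero_of_mem k n le_rfl hu
  rw [map_mul] at this
  exact mem_minorIdeal_of_toricMap_eq_zero k n le_rfl u
    ((mul_eq_zero.1 this).resolve_left (toricMap_hPoly_ne_zero hf dg))

/-- A form of positive degree is not a unit, so it is not coprime to `0`. -/
theorem ne_zero_of_isRelPrime {f g : BaseRing k n} {d : ℕ} (hd : 2 ≤ d)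
    (hg : g.IsHomogeneous d) (hfg : IsRelPrime f g) : f ≠ 0 := by
  rintro rfl
  have hu := isRelPrime_zero_left.1 hfg
  have := (MvPolynomial.isUnit_iff_totalDegree_of_isReduced.1 hu).2
  rw [hg.totalDegree hu.ne_zero] at this
  omega

end Generic

/-! ### The presentation of the symmetric algebra -/

section Presentation

/-- The kernel of a presentation `R[y_j] → Sym_R(M)` is generated by the linear forms that come
from the relations between the generators of `M`. -/
theorem mem_of_aeval_ι_eq_zero {R σ M : Type*} [CommRing R] [Fintype σ] [AddCommGroup M]
    [Module R M] (v : σ → M) (hv : ∀ x, ∃ a : σ → R, ∑ j, a j • v j = x)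
    (J : Ideal (MvPolynomial σ R))
    (hJ : ∀ a : σ → R, ∑ j, a j • v j = 0 → ∑ j, C (a j) * X j ∈ J) (b : MvPolynomial σ R)
    (hb : aeval (fun j => SymmetricAlgebra.ι R M (v j)) b = 0) : b ∈ J := by
  classical
  let P : (σ → R) →ₗ[R] M := Fintype.linearCombination R v
  let Q : (σ → R) →ₗ[R] (MvPolynomial σ R ⧸ J) :=
    Fintype.linearCombination R fun j => Ideal.Quotient.mk J (X j)
  have hQ : ∀ a, Q a = Ideal.Quotient.mk J (∑ j, C (a j) * X j) := fun a => by
    simp only [Q, Fintype.linearCombination_apply, map_sum]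
    refine Finset.sum_congr rfl fun j _ => ?_
    rw [← smul_eq_C_mul]
    rfl
  have hPsurj : Function.Surjective P := hv
  have hle : LinearMap.ker P ≤ LinearMap.ker Q := by
    intro a ha
    rw [LinearMap.mem_ker, hQ, Ideal.Quotient.eq_zero_iff_mem]
    exact hJ a ha
  let θ : M →ₗ[R] (MvPolynomial σ R ⧸ J) :=
    ((LinearMap.ker P).liftQ Q hle).comp (P.quotKerEquivOfSurjective hPsurj).symm.toLinearMap
  have hθ : ∀ a, θ (P a) = Q a := by
    intro a
    have : (P.quotKerEquivOfSurjective hPsurj).symm (P a) = Submodule.Quotient.mk a := by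
      rw [LinearEquiv.symm_apply_eq]
      rfl
    simp only [θ, LinearMap.comp_apply, LinearEquiv.coe_coe, this]
    rfl
  have hcomp : (SymmetricAlgebra.lift θ).comp (aeval fun j => SymmetricAlgebra.ι R M (v j)) =
      Ideal.Quotient.mkₐ R J := by
    refine MvPolynomial.algHom_ext fun j => ?_
    rw [AlgHom.comp_apply, aeval_X, SymmetricAlgebra.lift_ι_apply]
    have : v j = P (Pi.single j 1) := by
      simp [P]
    rw [this, hθ, hQ]
    simp [Pi.single_apply, apply_ite C]
  have := DFunLike.congr_fun hcomp b
  rw [AlgHom.comp_apply, hb, map_zero] at this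
  exact Ideal.Quotient.eq_zero_iff_mem.1 this.symm

variable {k : Type*} [Field k] {n : ℕ}

/-- The defining ideal of the symmetric algebra: the minors of `ψ` together with `h`. -/
noncomputable def symIdeal (f : BaseRing k n) (dg : Fin n → BaseRing k n) : Ideal (BigRing k n) :=
  minorIdeal (xRow k n) (yRow k n) n ⊔ Ideal.span {hPoly f dg}

theorem gen_castSucc (f g : BaseRing k n) (i : Fin n) : gen f g i.castSucc = f * X i := by
  simp [gen]

theorem gen_last (f g : BaseRing k n) : gen f g (Fin.last n) = g := by
  simp [gen]

/-- A syzygy of `x_1, …, x_n` is a combination of the Koszul syzygies. -/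
theorem sum_C_mul_mem_minorIdeal (a : Fin n → BaseRing k n) (ha : ∑ i, a i * X i = 0) :
    ∑ i, C (a i) * yRow k n i ∈ minorIdeal (xRow k n) (yRow k n) n := by
  refine mem_minorIdeal_of_toricMap_eq_zero k n le_rfl _ ?_
  have h := congr_arg (fun r => toricMap k n le_rfl (C r)) ha
  simp only [map_sum, map_mul, map_zero] at h
  simp only [map_sum, map_mul, yRow, toricMap_y_of_lt k n le_rfl _ (Fin.is_lt _)]
  calc _ = X none * ∑ i, toricMap k n le_rfl (C (a i)) * toricMap k n le_rfl (C (X i)) := by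
        rw [Finset.mul_sum]
        refine Finset.sum_congr rfl fun i _ => ?_
        rw [toricMap_x]
        ring
    _ = 0 := by rw [h, mul_zero]

/-- The syzygies of `f x_1, …, f x_n, g` are generated by the Koszul syzygies of the `x_i` and by
`(∂_1, …, ∂_n, -f)`. -/
theorem sum_C_mul_X_mem_symIdeal {d : ℕ} {f g : BaseRing k n} (hf : f ≠ 0) (hfg : IsRelPrime f g)
    {dg : Fin n → BaseRing k n} (hdg : IsPartialColumn d g dg) (a : Fin (n + 1) → BaseRing k n)
    (ha : ∑ j, a j * gen f g j = 0) : ∑ j, C (a j) * X j ∈ symIdeal f dg := by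
  rw [Fin.sum_univ_castSucc] at ha ⊢
  simp only [gen_castSucc, gen_last] at ha
  have hdvd : f ∣ a (Fin.last n) := by
    refine hfg.dvd_of_dvd_mul_right (y := a (Fin.last n)) ?_
    rw [eq_neg_of_add_eq_zero_right ha, dvd_neg]
    exact Finset.dvd_sum fun i _ => ⟨a i.castSucc * X i, by ring⟩
  obtain ⟨c, hc⟩ := hdvd
  have h0 : ∑ i : Fin n, (a i.castSucc + c * dg i) * X i = 0 := by
    refine (mul_eq_zero.1 (?_ : f * _ = 0)).resolve_left hf
    rw [← ha, hc, ← hdg.2, Finset.mul_sum, Finset.mul_sum, ← Finset.sum_add_distrib]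
    exact Finset.sum_congr rfl fun i _ => by ring
  have h1 := sum_C_mul_mem_minorIdeal _ h0
  have h2 : ∑ i : Fin n, C (a i.castSucc) * X i.castSucc + C (a (Fin.last n)) * X (Fin.last n) =
      ∑ i, C (a i.castSucc + c * dg i) * yRow k n i - C c * hPoly f dg := by
    simp only [hPoly, hc, mul_sub, Finset.mul_sum, map_add, map_mul, add_mul,
      Finset.sum_add_distrib, mul_assoc]
    ring
  rw [h2]
  exact sub_mem (Ideal.mem_sup_left h1)
    (Ideal.mem_sup_right (Ideal.mul_mem_left _ _ (Ideal.mem_span_singleton_self _)))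

theorem symHom_X (f g : BaseRing k n) (j : Fin (n + 1)) :
    symHom f g (X j) = SymmetricAlgebra.ι (BaseRing k n) (baseIdeal f g)
      ⟨gen f g j, Ideal.subset_span ⟨j, rfl⟩⟩ := by
  simp [symHom]

/-- The linear form `∑ a_j y_j` is sent to the element `∑ a_j g_j` of `I`. -/
theorem symHom_sum (f g : BaseRing k n) (a : Fin (n + 1) → BaseRing k n)
    (h : ∑ j, a j * gen f g j ∈ baseIdeal f g) :
    symHom f g (∑ j, C (a j) * X j) = SymmetricAlgebra.ι (BaseRing k n) (baseIdeal f g)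
      ⟨∑ j, a j * gen f g j, h⟩ := by
  have : (⟨∑ j, a j * gen f g j, h⟩ : baseIdeal f g) =
      ∑ j, a j • ⟨gen f g j, Ideal.subset_span ⟨j, rfl⟩⟩ := by
    ext
    simp
  rw [this, map_sum, map_sum]
  refine Finset.sum_congr rfl fun j _ => ?_
  rw [map_smul, ← symHom_X, ← smul_eq_C_mul, map_smul]

theorem symIdeal_le_ker {d : ℕ} {f g : BaseRing k n} {dg : Fin n → BaseRing k n}
    (hdg : IsPartialColumn d g dg) {b : BigRing k n} (hb : b ∈ symIdeal f dg) :
    symHom f g b = 0 := by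
  have hι : ∀ (a : Fin (n + 1) → BaseRing k n), ∑ j, a j * gen f g j = 0 →
      symHom f g (∑ j, C (a j) * X j) = 0 := by
    intro a ha
    rw [symHom_sum f g a (by rw [ha]; exact zero_mem _)]
    exact (congr_arg _ (Subtype.ext ha)).trans (map_zero _)
  have : symIdeal f dg ≤ RingHom.ker (symHom f g) := by
    refine sup_le (Ideal.span_le.2 ?_) ((Ideal.span_singleton_le_iff_mem _).2 ?_)
    · rintro _ ⟨i, j, -, -, rfl⟩
      have := hι (Pi.single j.castSucc (X i) - Pi.single i.castSucc (X j)) (by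
        simp only [Pi.sub_apply, sub_mul, Finset.sum_sub_distrib]
        simp [Pi.single_apply, ite_mul, gen_castSucc]
        ring)
      simp only [Pi.sub_apply, map_sub, sub_mul, Finset.sum_sub_distrib, Pi.single_apply,
        apply_ite C, map_zero, ite_mul, zero_mul, Finset.sum_ite_eq', Finset.mem_univ,
        if_true] at this
      simp only [SetLike.mem_coe, RingHom.mem_ker, map_sub]
      exact this
    · rw [RingHom.mem_ker]
      have := hι (Fin.snoc dg (-f)) (by
        rw [Fin.sum_univ_castSucc]
        simp only [Fin.snoc_castSucc, Fin.snoc_last, gen_castSucc, gen_last]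
        rw [← hdg.2, Finset.mul_sum, ← Finset.sum_add_distrib]
        exact Finset.sum_eq_zero fun i _ => by ring)
      rw [Fin.sum_univ_castSucc] at this
      simp only [Fin.snoc_castSucc, Fin.snoc_last] at this
      have hh : hPoly f dg = ∑ i, C (dg i) * X i.castSucc + C (-f) * X (Fin.last n) := by
        rw [hPoly, map_neg]
        ring
      rw [hh]
      exact this
  exact this hb

theorem mem_symIdeal_of_symHom_eq_zero {d : ℕ} {f g : BaseRing k n} (hf : f ≠ 0)
    (hfg : IsRelPrime f g) {dg : Fin n → BaseRing k n} (hdg : IsPartialColumn d g dg)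
    {b : BigRing k n} (hb : symHom f g b = 0) : b ∈ symIdeal f dg := by
  refine mem_of_aeval_ι_eq_zero
    (fun j => (⟨gen f g j, Ideal.subset_span ⟨j, rfl⟩⟩ : baseIdeal f g)) ?_ _ ?_ b hb
  · rintro ⟨r, hr⟩
    obtain ⟨a, ha⟩ := Ideal.mem_span_range_iff_exists_fun.1 hr
    exact ⟨a, Subtype.ext (by simpa using ha)⟩
  · intro a ha
    refine sum_C_mul_X_mem_symIdeal hf hfg hdg a ?_
    simpa using congr_arg Subtype.val ha

theorem symHom_surjective (f g : BaseRing k n) : Function.Surjective (symHom f g) := by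
  rw [← AlgHom.range_eq_top, eq_top_iff]
  rintro s -
  induction s using SymmetricAlgebra.induction with
  | algebraMap r => exact Subalgebra.algebraMap_mem _ r
  | ι r =>
    obtain ⟨r, hr⟩ := r
    obtain ⟨a, rfl⟩ := Ideal.mem_span_range_iff_exists_fun.1 hr
    exact ⟨_, symHom_sum f g a hr⟩
  | mul a b ha hb => exact mul_mem ha hb
  | add a b ha hb => exact add_mem ha hb

end Presentation

/-! ### The bigrading -/

section Grading

variable {k : Type*} [Field k] {n : ℕ}

/-- The bidegrees of the variables. -/
def biweight (n : ℕ) : Fin (n + 1) ⊕ Fin n → ℤ × ℤ :=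
  Sum.elim (fun _ => (0, 1)) (fun _ => (1, 0))

/-- The weight of a monomial `x^s y^t` is `(|s|, |t|)`. -/
theorem weight_biweight (d : Fin (n + 1) ⊕ Fin n →₀ ℕ) :
    Finsupp.weight (biweight n) d =
      (((Finsupp.sumFinsuppAddEquivProdFinsupp d).2.degree : ℤ),
        ((Finsupp.sumFinsuppAddEquivProdFinsupp d).1.degree : ℤ)) := by
  rw [Finsupp.weight_apply, Finsupp.sum_fintype _ _ (by simp), Fintype.sum_sum_type]
  ext <;> simp [biweight, Finsupp.degree_eq_sum, Prod.fst_sum, Prod.snd_sum]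

theorem coeff_coeff_bigRingEquiv (q : MvPolynomial (Fin (n + 1) ⊕ Fin n) k)
    (d : Fin (n + 1) ⊕ Fin n →₀ ℕ) :
    ((bigRingEquiv k n q).coeff (Finsupp.sumFinsuppAddEquivProdFinsupp d).1).coeff
      (Finsupp.sumFinsuppAddEquivProdFinsupp d).2 = q.coeff d := by
  classical
  have hmon : ∀ (e : Fin (n + 1) ⊕ Fin n →₀ ℕ) (a : k), bigRingEquiv k n (monomial e a) =
      monomial (Finsupp.sumFinsuppAddEquivProdFinsupp e).1
        (monomial (Finsupp.sumFinsuppAddEquivProdFinsupp e).2 a) := by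
    intro e a
    rw [bigRingEquiv, sumAlgEquiv, AlgEquiv.trans_apply]
    exact (congr_arg _ (AddMonoidAlgebra.domCongr_single ..)).trans
      (AddMonoidAlgebra.curryAlgEquiv_single ..)
  induction q using MvPolynomial.induction_on' with
  | monomial e a =>
    rw [hmon, coeff_monomial, coeff_monomial]
    by_cases h : e = d
    · simp [h]
    · rw [if_neg h]
      split_ifs with h1
      · rw [coeff_monomial, if_neg]
        intro h2
        exact h (Finsupp.sumFinsuppAddEquivProdFinsupp.injective (Prod.ext h1 h2))
      · simp
  | add p q hp hq => rw [map_add, coeff_add, coeff_add, coeff_add, hp, hq]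

theorem bigRingEquiv_mem_bipart_iff (q : MvPolynomial (Fin (n + 1) ⊕ Fin n) k) (c : ℤ × ℤ) :
    bigRingEquiv k n q ∈ bipart k n c ↔ IsWeightedHomogeneous (biweight n) q c := by
  constructor
  · intro h d hd
    rw [weight_biweight]
    exact h _ _ (by rwa [coeff_coeff_bigRingEquiv])
  · intro h t s hts
    have := h (d := Finsupp.sumFinsuppAddEquivProdFinsupp.symm (t, s))
    rw [weight_biweight, ← coeff_coeff_bigRingEquiv, AddEquiv.apply_symm_apply] at this
    exact this hts

theorem mem_bipart_iff (b : BigRing k n) (c : ℤ × ℤ) :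
    b ∈ bipart k n c ↔ IsWeightedHomogeneous (biweight n) ((bigRingEquiv k n).symm b) c := by
  rw [← bigRingEquiv_mem_bipart_iff, AlgEquiv.apply_symm_apply]

theorem mul_mem_bipart {a b : BigRing k n} {c e : ℤ × ℤ} (ha : a ∈ bipart k n c)
    (hb : b ∈ bipart k n e) : a * b ∈ bipart k n (c + e) := by
  rw [mem_bipart_iff] at ha hb ⊢
  rw [map_mul]
  exact ha.mul hb

theorem X_mem_bipart (j : Fin (n + 1)) : (X j : BigRing k n) ∈ bipart k n (0, 1) := by
  rw [mem_bipart_iff, sumAlgEquiv_symm_X]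
  exact isWeightedHomogeneous_X k (biweight n) (.inl j)

theorem C_mem_bipart {r : BaseRing k n} {m : ℕ} (hr : r.IsHomogeneous m) :
    (C r : BigRing k n) ∈ bipart k n ((m : ℤ), 0) := by
  classical
  intro t s hts
  rw [coeff_C] at hts
  split_ifs at hts with h
  · have := hr hts
    have hs : s.degree = m := by
      rw [Finsupp.degree_eq_weight_one]
      exact this
    simp [← h, hs]
  · simp at hts

theorem C_X_mem_bipart (i : Fin n) : (C (X i) : BigRing k n) ∈ bipart k n (1, 0) :=
  C_mem_bipart (isHomogeneous_X k i)

/-- The projection of `B` to its part of bidegree `c`. -/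
noncomputable def bicomp (c : ℤ × ℤ) : BigRing k n →+ BigRing k n where
  toFun b :=
    bigRingEquiv k n (weightedHomogeneousComponent (biweight n) c ((bigRingEquiv k n).symm b))
  map_zero' := by rw [map_zero, map_zero, map_zero]
  map_add' a b := by rw [map_add, map_add, map_add]

theorem bicomp_apply (c : ℤ × ℤ) (b : BigRing k n) : bicomp c b =
    bigRingEquiv k n (weightedHomogeneousComponent (biweight n) c ((bigRingEquiv k n).symm b)) :=
  rfl

theorem bicomp_mem (c : ℤ × ℤ) (b : BigRing k n) : bicomp c b ∈ bipart k n c := by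
  rw [bicomp_apply, bigRingEquiv_mem_bipart_iff]
  exact weightedHomogeneousComponent_isWeightedHomogeneous _ _

theorem bicomp_of_mem {b : BigRing k n} {e : ℤ × ℤ} (hb : b ∈ bipart k n e) (c : ℤ × ℤ) :
    bicomp c b = if c = e then b else 0 := by
  classical
  rw [mem_bipart_iff] at hb
  rw [bicomp_apply]
  split_ifs with h
  · subst h
    rw [hb.weightedHomogeneousComponent_same, AlgEquiv.apply_symm_apply]
  · rw [weightedHomogeneousComponent_eq_zero', map_zero]
    intro d hd h'
    exact h (h'.symm.trans (hb (mem_support_iff.1 hd)))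

theorem exists_sum_bicomp (b : BigRing k n) : ∃ s : Finset (ℤ × ℤ), b = ∑ c ∈ s, bicomp c b := by
  have hf := weightedHomogeneousComponent_finsupp (w := biweight n) ((bigRingEquiv k n).symm b)
  refine ⟨hf.toFinset, ?_⟩
  simp only [bicomp_apply]
  rw [← map_sum, ← finsum_eq_sum _ hf, sum_weightedHomogeneousComponent,
    AlgEquiv.apply_symm_apply]

/-- An ideal generated by bihomogeneous elements contains the components of its elements. -/
theorem bicomp_mem_span {s : Set (BigRing k n)} (hs : ∀ x ∈ s, ∃ e, x ∈ bipart k n e)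
    {b : BigRing k n} (hb : b ∈ Ideal.span s) (c : ℤ × ℤ) : bicomp c b ∈ Ideal.span s := by
  have key : ∀ r : BigRing k n, ∀ x ∈ s, bicomp c (r * x) ∈ Ideal.span s := by
    intro r x hx
    obtain ⟨e, he⟩ := hs x hx
    obtain ⟨t, ht⟩ := exists_sum_bicomp r
    rw [ht, Finset.sum_mul, map_sum]
    refine Submodule.sum_mem _ fun c' _ => ?_
    rw [bicomp_of_mem (mul_mem_bipart (bicomp_mem c' r) he)]
    split_ifs
    · exact Ideal.mul_mem_left _ _ (Ideal.subset_span hx)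
    · exact zero_mem _
  induction hb using Submodule.closure_induction with
  | zero => rw [map_zero]; exact zero_mem _
  | add x y _ _ hx hy => rw [map_add]; exact add_mem hx hy
  | smul_mem r x hx => exact key r x hx

theorem minor_mem_bipart (i j : Fin n) :
    xRow k n i * yRow k n j - xRow k n j * yRow k n i ∈ bipart k n (1, 1) :=
  sub_mem (mul_mem_bipart (C_X_mem_bipart i) (X_mem_bipart _))
    (mul_mem_bipart (C_X_mem_bipart j) (X_mem_bipart _))

theorem hPoly_mem_bipart {d : ℕ} (hd : 2 ≤ d) {f g : BaseRing k n} (hf : f.IsHomogeneous (d - 1))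
    {dg : Fin n → BaseRing k n} (hdg : IsPartialColumn d g dg) :
    hPoly f dg ∈ bipart k n ((d : ℤ) - 1, 1) := by
  have hcast : ((d - 1 : ℕ) : ℤ) = (d : ℤ) - 1 := by omega
  have hC : ∀ r : BaseRing k n, r.IsHomogeneous (d - 1) → ∀ j : Fin (n + 1),
      (C r * X j : BigRing k n) ∈ bipart k n ((d : ℤ) - 1, 1) := by
    intro r hr j
    have := mul_mem_bipart (C_mem_bipart hr) (X_mem_bipart (k := k) j)
    simpa [hcast] using this
  exact sub_mem (sum_mem fun i _ => hC _ (hdg.1 i) _) (hC _ hf _)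

theorem bicomp_mem_symIdeal {d : ℕ} (hd : 2 ≤ d) {f g : BaseRing k n}
    (hf : f.IsHomogeneous (d - 1)) {dg : Fin n → BaseRing k n} (hdg : IsPartialColumn d g dg)
    {b : BigRing k n} (hb : b ∈ symIdeal f dg) (c : ℤ × ℤ) : bicomp c b ∈ symIdeal f dg := by
  rw [symIdeal, minorIdeal, ← Ideal.span_union] at hb ⊢
  refine bicomp_mem_span ?_ hb c
  rintro x (⟨i, j, -, -, rfl⟩ | rfl)
  · exact ⟨_, minor_mem_bipart i j⟩
  · exact ⟨_, hPoly_mem_bipart hd hf hdg⟩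

/-- The bigrading of `B` descends to the symmetric algebra, because the defining ideal is generated
by bihomogeneous elements. -/
theorem isBigrading_symPart {d : ℕ} (hd : 2 ≤ d) {f g : BaseRing k n}
    (hf : f.IsHomogeneous (d - 1)) (hf0 : f ≠ 0) (hfg : IsRelPrime f g)
    {dg : Fin n → BaseRing k n} (hdg : IsPartialColumn d g dg) :
    IsBigrading k n (symPart f g) where
  isInternal := by
    classical
    constructor
    · rw [injective_iff_map_eq_zero]
      intro x hx
      have hlift : ∀ c, ∃ b ∈ bipart k n c, symHom f g b = x c := fun c => (x c).2
      choose b hb hbx using hlift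
      have hsum : symHom f g (∑ c ∈ x.support, b c) = 0 := by
        rw [map_sum, Finset.sum_congr rfl fun c _ => hbx c]
        rw [← hx, DirectSum.coeAddMonoidHom_eq_dfinsuppSum]
        rfl
      have hmem := mem_symIdeal_of_symHom_eq_zero hf0 hfg hdg hsum
      ext c
      by_cases hc : c ∈ x.support
      · have h1 := bicomp_mem_symIdeal hd hf hdg hmem c
        rw [map_sum, Finset.sum_congr rfl fun e _ => bicomp_of_mem (hb e) c,
          Finset.sum_ite_eq, if_pos hc] at h1
        rw [← hbx, symIdeal_le_ker hdg h1]
        rfl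
      · rw [DFinsupp.notMem_support_iff.1 hc]
        rfl
    · intro s
      obtain ⟨b, rfl⟩ := symHom_surjective f g s
      obtain ⟨t, ht⟩ := exists_sum_bicomp b
      refine ⟨∑ c ∈ t, DirectSum.of (fun c => symPart f g c) c
        ⟨symHom f g (bicomp c b), bicomp c b, bicomp_mem c b, rfl⟩, ?_⟩
      rw [map_sum]
      simp only [DirectSum.coeAddMonoidHom_of]
      rw [← map_sum, ← ht]
  smul_mem := by
    rintro c e b _ hb ⟨b', hb', rfl⟩
    refine ⟨b * b', mul_mem_bipart hb hb', ?_⟩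
    rw [Algebra.smul_def]
    exact map_mul (symHom f g) b b'

end Grading

/-! ### The minimal resolution -/

section Resolution

variable {k : Type*} [Field k] {n : ℕ}

theorem mulVecLin_mem_freePart {ι κ : Type} [Fintype κ] {deg : ι → ℤ × ℤ} {deg' : κ → ℤ × ℤ}
    (D : Matrix ι κ (BigRing k n)) (hD : ∀ r s, D r s ∈ bipart k n (deg' s - deg r))
    {c : ℤ × ℤ} {v : κ → BigRing k n} (hv : v ∈ freePart deg' c) :
    D.mulVecLin v ∈ freePart deg c := by
  intro r
  refine sum_mem fun s _ => ?_
  have := mul_mem_bipart (hD r s) (hv s)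
  rwa [show deg' s - deg r + (c - deg' s) = c - deg r by abel] at this

theorem neg_one_pow_mul_mem {M : Type*} [Ring M] (H : AddSubgroup M) {x : M} (hx : x ∈ H) (j : ℕ) :
    (-1) ^ j * x ∈ H := by
  rcases neg_one_pow_eq_or M j with h | h
  · rwa [h, one_mul]
  · rw [h, neg_one_mul]
    exact neg_mem hx

theorem enD_mem_bipart (i : ℕ) (r : ENIndex n i) (s : ENIndex n (i + 1)) :
    enD (psi k n) i r s ∈ bipart k n (enDeg n (i + 1) s - enDeg n i r) := by
  rcases i with _ | i
  · have h0 : (s.2 : ℕ) = 0 := by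
      have : (s.2 : ℕ) < 0 + 1 := s.2.2
      omega
    have : enDeg n 1 s - enDeg n 0 r = (1, 1) := by
      simp [enDeg]
    rw [this]
    change ((psi k n).submatrix id (s.1.1.orderEmbOfFin s.1.2)).det ∈ _
    rw [Matrix.det_fin_two]
    exact minor_mem_bipart _ _
  · refine sum_mem fun j _ => ?_
    have hdeg : enDeg n (i + 1 + 1) s - enDeg n (i + 1) r =
        ((s.2 : ℤ) - (r.2 : ℤ), 1 - (s.2 : ℤ) + (r.2 : ℤ)) := by
      ext
      · simp [enDeg]
      · simp [enDeg]
        ring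
    rw [hdeg]
    split_ifs with h1 h2 h3 h3
    · omega
    · rw [add_zero]
      refine neg_one_pow_mul_mem _ ?_ _
      have : ((s.2 : ℤ) - (r.2 : ℤ), 1 - (s.2 : ℤ) + (r.2 : ℤ)) = (1, 0) := by
        ext <;> simp only <;> omega
      rw [this]
      exact C_X_mem_bipart _
    · rw [zero_add]
      refine neg_one_pow_mul_mem _ ?_ _
      have : ((s.2 : ℤ) - (r.2 : ℤ), 1 - (s.2 : ℤ) + (r.2 : ℤ)) = (0, 1) := by
        ext <;> simp only <;> omega
      rw [this]
      exact X_mem_bipart _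
    · rw [add_zero, mul_zero]
      exact zero_mem _
    · exact zero_mem _

theorem scalar_mem {ι M : Type*} [DecidableEq ι] [CommRing M] [Fintype ι] (H : AddSubgroup M)
    {x : M} (r s : ι) (hx : r = s → x ∈ H) : Matrix.scalar ι x r s ∈ H := by
  rw [Matrix.scalar_apply, Matrix.diagonal_apply]
  split_ifs with h
  · exact hx h
  · exact zero_mem _

theorem coneD_mem_bipart {d : ℕ} {h : BigRing k n} (hh : h ∈ bipart k n ((d : ℤ) - 1, 1)) (i : ℕ)
    (r : ConeIndex n i) (s : ConeIndex n (i + 1)) :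
    coneD (psi k n) h i r s ∈ bipart k n (coneDeg n d (i + 1) s - coneDeg n d i r) := by
  rcases i with _ | i
  · rcases s with s | s
    · refine scalar_mem (ι := ENIndex n 0) _ r s fun hrs => ?_
      have : coneDeg n d (0 + 1) (.inl s) - coneDeg n d 0 r = ((d : ℤ) - 1, 1) := by
        simp [coneDeg, enDeg]
      rwa [this]
    · exact enD_mem_bipart 0 r s
  · rcases r with r | r <;> rcases s with s | s
    · have : coneDeg n d (i + 1 + 1) (.inl s) - coneDeg n d (i + 1) (.inl r) =
          enDeg n (i + 1) s - enDeg n i r := by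
        simp [coneDeg]
      rw [this]
      exact neg_mem (enD_mem_bipart i r s)
    · exact zero_mem _
    · refine scalar_mem (ι := ENIndex n (i + 1)) _ r s fun hrs => ?_
      subst hrs
      have : coneDeg n d (i + 1 + 1) (.inl r) - coneDeg n d (i + 1) (.inr r) =
          ((d : ℤ) - 1, 1) := by
        simp [coneDeg]
      rwa [this]
    · exact enD_mem_bipart (i + 1) r s

theorem X_mem_irrelevantIdeal (j : Fin (n + 1)) : (X j : BigRing k n) ∈ irrelevantIdeal k n :=
  Ideal.subset_span (Or.inr ⟨j, rfl⟩)

theorem C_X_mem_irrelevantIdeal (i : Fin n) : (C (X i) : BigRing k n) ∈ irrelevantIdeal k n :=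
  Ideal.subset_span (Or.inl ⟨i, rfl⟩)

theorem hPoly_mem_irrelevantIdeal (f : BaseRing k n) (dg : Fin n → BaseRing k n) :
    hPoly f dg ∈ irrelevantIdeal k n :=
  sub_mem (sum_mem fun _ _ => Ideal.mul_mem_left _ _ (X_mem_irrelevantIdeal _))
    (Ideal.mul_mem_left _ _ (X_mem_irrelevantIdeal _))

theorem enD_mem_irrelevantIdeal (i : ℕ) (r : ENIndex n i) (s : ENIndex n (i + 1)) :
    enD (psi k n) i r s ∈ irrelevantIdeal k n := by
  rcases i with _ | i
  · change ((psi k n).submatrix id (s.1.1.orderEmbOfFin s.1.2)).det ∈ _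
    rw [Matrix.det_fin_two]
    exact sub_mem (Ideal.mul_mem_left _ _ (X_mem_irrelevantIdeal _))
      (Ideal.mul_mem_right _ _ (C_X_mem_irrelevantIdeal _))
  · refine sum_mem fun j _ => ?_
    split_ifs
    · exact Ideal.mul_mem_left _ _
        (add_mem (C_X_mem_irrelevantIdeal _) (X_mem_irrelevantIdeal _))
    · exact Ideal.mul_mem_left _ _ (add_mem (C_X_mem_irrelevantIdeal _) (zero_mem _))
    · exact Ideal.mul_mem_left _ _ (add_mem (zero_mem _) (X_mem_irrelevantIdeal _))
    · exact Ideal.mul_mem_left _ _ (add_mem (zero_mem _) (zero_mem _))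
    · exact zero_mem _

theorem coneD_mem_irrelevantIdeal {h : BigRing k n} (hh : h ∈ irrelevantIdeal k n) (i : ℕ)
    (r : ConeIndex n i) (s : ConeIndex n (i + 1)) :
    coneD (psi k n) h i r s ∈ irrelevantIdeal k n := by
  rcases i with _ | i
  · rcases s with s | s
    · exact scalar_mem (ι := ENIndex n 0) (irrelevantIdeal k n).toAddSubgroup r s fun _ => hh
    · exact enD_mem_irrelevantIdeal 0 r s
  · rcases r with r | r <;> rcases s with s | s
    · exact neg_mem (enD_mem_irrelevantIdeal i r s)
    · exact zero_mem _
    · exact scalar_mem (ι := ENIndex n (i + 1)) (irrelevantIdeal k n).toAddSubgroup r s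
        fun _ => hh
    · exact enD_mem_irrelevantIdeal (i + 1) r s

theorem coneAug_apply (f g : BaseRing k n) (v : ConeIndex n 0 → BigRing k n) :
    coneAug f g v = symHom f g (v (ENIndex.zero n)) := rfl

/-- The image of the first differential of the mapping cone is the ideal generated by the minors
and `h`. -/
theorem mem_range_coneD_zero_iff (f : BaseRing k n) (dg : Fin n → BaseRing k n)
    (v : ConeIndex n 0 → BigRing k n) :
    v ∈ Set.range (coneD (psi k n) (hPoly f dg) 0).mulVecLin ↔
      v (ENIndex.zero n) ∈ symIdeal f dg := by
  have hD0 : ∀ (u : ENIndex n 0 → BigRing k n) (w : ENIndex n 1 → BigRing k n),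
      (coneD (psi k n) (hPoly f dg) 0).mulVec (coneVec u w) (ENIndex.zero n) =
        hPoly f dg * u (ENIndex.zero n) + (enD (psi k n) 0).mulVec w (ENIndex.zero n) := by
    intro u w
    refine (congr_fun (Matrix.fromCols_mulVec_sumElim _ _ _ _) _).trans ?_
    change (Matrix.scalar (ENIndex n 0) (hPoly f dg)).mulVec u (ENIndex.zero n) + _ = _
    congr 1
    simp [Matrix.scalar_apply, Matrix.mulVec_diagonal]
  rw [symIdeal, Submodule.mem_sup]
  constructor
  · rintro ⟨y, rfl⟩
    obtain ⟨u, w, rfl⟩ : ∃ (u : ENIndex n 0 → BigRing k n) (w : ENIndex n 1 → BigRing k n),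
        y = coneVec u w := ⟨fun s => y (Sum.inl s), fun s => y (Sum.inr s), by
      funext s
      rcases s with s | s <;> rfl⟩
    refine ⟨_, (mem_minorIdeal_iff (psi k n) _).2 ⟨w, rfl⟩, _,
      Ideal.mul_mem_right (u (ENIndex.zero n)) _ (Ideal.mem_span_singleton_self _), ?_⟩
    rw [Matrix.mulVecLin_apply, hD0, add_comm]
  · rintro ⟨a, ha, b, hb, hab⟩
    obtain ⟨w, rfl⟩ := (mem_minorIdeal_iff (psi k n) a).1 ha
    obtain ⟨u, rfl⟩ := Ideal.mem_span_singleton.1 hb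
    refine ⟨coneVec (fun _ => u) w, funext fun s => ?_⟩
    obtain rfl : s = ENIndex.zero n := rfl
    rw [Matrix.mulVecLin_apply, hD0, ← hab, add_comm]

/-- The mapping cone of multiplication by `h` is a minimal bigraded free resolution of the
symmetric algebra. -/
theorem isMinimalBigradedFreeResolution {d : ℕ} (hd : 2 ≤ d) {f g : BaseRing k n}
    (hf : f.IsHomogeneous (d - 1)) (hf0 : f ≠ 0) (hfg : IsRelPrime f g)
    {dg : Fin n → BaseRing k n} (hdg : IsPartialColumn d g dg) :
    IsMinimalBigradedFreeResolution (symPart f g) (ConeIndex n) (coneDeg n d)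
      (coneD (psi k n) (hPoly f dg)) (coneAug f g) where
  isBigrading := isBigrading_symPart hd hf hf0 hfg hdg
  surjective s := by
    obtain ⟨b, hb⟩ := symHom_surjective f g s
    exact ⟨fun _ => b, hb⟩
  exact_zero v := by
    rw [mem_range_coneD_zero_iff, coneAug_apply]
    exact ⟨mem_symIdeal_of_symHom_eq_zero hf0 hfg hdg, symIdeal_le_ker hdg⟩
  exact_succ := coneD_exact _ _
    (enD_exact (psi k n) (isRegularRow_xRow k) (isGenericPair_xRow_yRow k))
    (mem_minorIdeal_of_hPoly_mul_mem hf0 dg)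
  augmentation_mem c v hv := by
    refine ⟨_, ?_, rfl⟩
    have := hv (ENIndex.zero n)
    change _ ∈ bipart k n (c - 0) at this
    rwa [sub_zero] at this
  differential_mem i c v hv :=
    mulVecLin_mem_freePart _ (coneD_mem_bipart (hPoly_mem_bipart hd hf hdg) i) hv
  minimal := coneD_mem_irrelevantIdeal (hPoly_mem_irrelevantIdeal f dg)

end Resolution

/-! ### Partial columns, ranks and twists -/

section Shape

theorem homogeneousComponent_succ_X_mul {k σ : Type*} [CommSemiring k] (i : σ) (m : ℕ)
    (p : MvPolynomial σ k) :
    homogeneousComponent (m + 1) (X i * p) = X i * homogeneousComponent m p := by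
  classical
  ext e
  rw [coeff_homogeneousComponent, coeff_X_mul', coeff_X_mul', coeff_homogeneousComponent]
  by_cases hi : i ∈ e.support
  · have hle : Finsupp.single i 1 ≤ e := by
      rw [Finsupp.single_le_iff]
      exact Nat.one_le_iff_ne_zero.2 (Finsupp.mem_support_iff.1 hi)
    have : e.degree = (e - Finsupp.single i 1).degree + 1 := by
      conv_lhs => rw [← tsub_add_cancel_of_le hle]
      rw [map_add, Finsupp.degree_single]
    simp [hi, this]
  · simp [hi]

/-- A form of positive degree is a combination of the variables, and the coefficients may be
replaced with their components of the right degree. -/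
theorem exists_isPartialColumn {k : Type*} [Field k] {n d : ℕ} (hd : 1 ≤ d) {g : BaseRing k n}
    (hg : g.IsHomogeneous d) : ∃ dg, IsPartialColumn d g dg := by
  classical
  have hmem : g ∈ Ideal.span (X '' (Set.univ : Set (Fin n)) : Set (BaseRing k n)) := by
    rw [mem_ideal_span_X_image]
    intro e he
    have h1 : e.degree = d := by
      rw [Finsupp.degree_eq_weight_one]
      exact hg (mem_support_iff.1 he)
    by_contra! hcon
    have : e = 0 := by
      ext i
      exact hcon i (Set.mem_univ i)
    rw [this, map_zero] at h1
    omega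
  rw [Set.image_univ] at hmem
  obtain ⟨c, hc⟩ := Ideal.mem_span_range_iff_exists_fun.1 hmem
  refine ⟨fun i => homogeneousComponent (d - 1) (c i),
    fun i => homogeneousComponent_isHomogeneous _ _, ?_⟩
  have h2 : homogeneousComponent d g = g := by
    rw [homogeneousComponent_of_mem hg, if_pos rfl]
  obtain ⟨d, rfl⟩ : ∃ d', d = d' + 1 := ⟨d - 1, by omega⟩
  rw [← h2, ← hc, map_sum]
  refine Finset.sum_congr rfl fun i _ => ?_
  rw [mul_comm (c i), homogeneousComponent_succ_X_mul, Nat.add_sub_cancel]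

theorem isEmpty_ENIndex {n i : ℕ} (h : n ≤ i) (hi : 1 ≤ i) : IsEmpty (ENIndex n i) := by
  rcases i with _ | i
  · omega
  · refine ⟨fun s => ?_⟩
    have := s.1.2 ▸ Finset.card_le_univ s.1.1
    rw [Fintype.card_fin] at this
    omega

theorem nonempty_coneIndex {n : ℕ} (hn : 2 ≤ n) : Nonempty (ConeIndex n n) := by
  obtain ⟨m, rfl⟩ : ∃ m, n = m + 2 := ⟨n - 2, by omega⟩
  exact ⟨Sum.inl ((⟨Finset.univ, by simp⟩, 0) :
    {S : Finset (Fin (m + 2)) // S.card = m + 2} × Fin (m + 1))⟩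

theorem isEmpty_coneIndex {n i : ℕ} (hn : 2 ≤ n) (h : n < i) : IsEmpty (ConeIndex n i) := by
  rcases i with _ | i
  · omega
  · have h1 : IsEmpty (ENIndex n i) := isEmpty_ENIndex (by omega) (by omega)
    have h2 : IsEmpty (ENIndex n (i + 1)) := isEmpty_ENIndex (by omega) (by omega)
    exact ⟨fun s => s.elim h1.elim h2.elim⟩

theorem map_univ_eq_sum {ι α : Type*} [Fintype ι] (f : ι → α) :
    Finset.univ.val.map f = ∑ i, ({f i} : Multiset α) := by
  rw [← Multiset.sum_map_singleton (Finset.univ.val.map f), Multiset.map_map]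
  rfl

/-- The degrees in position `i + 1` of the Eagon–Northcott complex, shifted by means of `f`. -/
theorem map_enDeg_succ (n i : ℕ) {α : Type*} (f : ℤ × ℤ → α) :
    ∑ s, ({f (enDeg n (i + 1) s)} : Multiset α) = ∑ a ∈ Finset.range (i + 1),
      Multiset.replicate (n.choose (i + 2)) (f ((a : ℤ) + 1, (i : ℤ) - a + 1)) := by
  have h : ∑ s, ({f (enDeg n (i + 1) s)} : Multiset α) =
      ∑ s : {S : Finset (Fin n) // S.card = i + 2} × Fin (i + 1),
        {f ((s.2 : ℤ) + 1, (i : ℤ) - (s.2 : ℤ) + 1)} := rfl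
  rw [h, Fintype.sum_prod_type_right, ← Fin.sum_univ_eq_sum_range
    (fun a => Multiset.replicate (n.choose (i + 2)) (f ((a : ℤ) + 1, (i : ℤ) - a + 1)))]
  refine Finset.sum_congr rfl fun a _ => ?_
  refine (Finset.sum_const (s := (Finset.univ : Finset {S : Finset (Fin n) // S.card = i + 2}))
    ({f ((a : ℤ) + 1, (i : ℤ) - (a : ℤ) + 1)} : Multiset α)).trans ?_
  rw [Finset.card_univ, Fintype.card_finset_len, Fintype.card_fin,
    Multiset.nsmul_singleton]

theorem map_coneDeg_succ (n d i : ℕ) : Finset.univ.val.map (coneDeg n d (i + 1)) =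
    ∑ s, {enDeg n i s + ((d : ℤ) - 1, 1)} + ∑ s, {enDeg n (i + 1) s} := by
  rw [map_univ_eq_sum]
  exact Fintype.sum_sum_type _

theorem map_coneDeg_zero (n d : ℕ) : Finset.univ.val.map (coneDeg n d 0) = {(0, 0)} := rfl

theorem map_coneDeg_one (n d : ℕ) : Finset.univ.val.map (coneDeg n d 1) =
    {((d : ℤ) - 1, 1)} + Multiset.replicate (n.choose 2) (1, 1) := by
  rw [map_coneDeg_succ]
  congr 1
  · have : ∑ s, ({enDeg n 0 s + ((d : ℤ) - 1, 1)} : Multiset (ℤ × ℤ)) =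
      {(0, 0) + ((d : ℤ) - 1, 1)} := rfl
    rw [this]
    simp
  · exact (map_enDeg_succ n 0 id).trans (by simp)

theorem map_coneDeg (n d i : ℕ) (hi : 2 ≤ i) : Finset.univ.val.map (coneDeg n d i) =
    ∑ a ∈ Finset.range (i - 1), Multiset.replicate (n.choose i) ((d : ℤ) + a, (i : ℤ) - a) +
      ∑ a ∈ Finset.range i,
        Multiset.replicate (n.choose (i + 1)) ((a : ℤ) + 1, (i : ℤ) - a) := by
  obtain ⟨j, rfl⟩ : ∃ j, i = j + 2 := ⟨i - 2, by omega⟩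
  rw [map_coneDeg_succ]
  congr 1
  · refine (map_enDeg_succ n j fun c => c + ((d : ℤ) - 1, 1)).trans ?_
    refine Finset.sum_congr rfl fun a _ => ?_
    congr 1
    ext
    · simp only [Prod.fst_add]
      ring
    · simp only [Prod.snd_add]
      push_cast
      ring
  · refine (map_enDeg_succ n (j + 1) id).trans ?_
    refine Finset.sum_congr rfl fun a _ => ?_
    congr 1
    ext
    · simp
    · simp only [id]
      push_cast
      ring

end Shape

/-! ### Rings finite and flat over a polynomial ring -/

section CohenMacaulayCriterion

open RingTheory.Sequence

/-- A monic polynomial is a nonzerodivisor modulo every ideal of coefficients. -/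
theorem mem_map_C_of_monic_mul_mem {R : Type*} [CommRing R] (J : Ideal R) {y a : Polynomial R}
    (hy : y.Monic) (h : y * a ∈ J.map Polynomial.C) : a ∈ J.map Polynomial.C := by
  rw [← Ideal.mk_ker (I := J), ← Polynomial.ker_mapRingHom, RingHom.mem_ker,
    Polynomial.coe_mapRingHom] at h ⊢
  rw [Polynomial.map_mul] at h
  exact (hy.map _).mul_right_eq_zero_iff.1 h

theorem exists_monic_mem_of_isMaximal {R : Type*} [CommRing R] [IsJacobsonRing R]
    (q : Ideal (Polynomial R)) [q.IsMaximal] : ∃ y ∈ q, y.Monic := by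
  obtain ⟨y, hy, h0⟩ := Polynomial.quotient_mk_comp_C_isIntegral_of_isJacobsonRing q
    (Ideal.Quotient.mk q Polynomial.X)
  refine ⟨y, ?_, hy⟩
  rw [← Polynomial.hom_eval₂, Polynomial.eval₂_C_X] at h0
  exact Ideal.Quotient.eq_zero_iff_mem.1 h0

/-- Every maximal ideal of `k[x_1, …, x_m]` contains a regular sequence of length `m`. -/
theorem exists_isWeaklyRegular_of_isMaximal {k : Type*} [Field k] (m : ℕ)
    (q : Ideal (MvPolynomial (Fin m) k)) [q.IsMaximal] :
    ∃ rs : List (MvPolynomial (Fin m) k), rs.length = m ∧ (∀ r ∈ rs, r ∈ q) ∧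
      IsWeaklyRegular (MvPolynomial (Fin m) k) rs := by
  induction m with
  | zero => exact ⟨[], rfl, by simp, by simp⟩
  | succ m ih =>
    let e := (finSuccEquiv k m).toRingEquiv
    let q' : Ideal (Polynomial (MvPolynomial (Fin m) k)) := q.comap (e.symm : _ →+* _)
    have hq' : q'.IsMaximal := Ideal.comap_isMaximal_of_surjective _ e.symm.surjective
    have hq0 : (q'.comap Polynomial.C).IsMaximal :=
      Polynomial.isMaximal_comap_C_of_isJacobsonRing q'
    obtain ⟨rs, hlen, hmem, hreg⟩ := ih (q'.comap Polynomial.C)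
    obtain ⟨y, hyq, hy⟩ := exists_monic_mem_of_isMaximal q'
    -- a sequence in the contraction of `q`, followed by a monic polynomial
    have h1 : IsWeaklyRegular (Polynomial (MvPolynomial (Fin m) k))
        (rs.map (algebraMap _ (Polynomial (MvPolynomial (Fin m) k))) ++ [y]) := by
      rw [isWeaklyRegular_append_iff]
      refine ⟨hreg.of_flat, ?_⟩
      rw [isWeaklyRegular_singleton_iff, ← Ideal.map_ofList,
        isSMulRegular_iff_right_eq_zero_of_smul]
      intro x hx
      obtain ⟨x, rfl⟩ := Submodule.Quotient.mk_surjective _ x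
      rw [← Submodule.Quotient.mk_smul, Submodule.Quotient.mk_eq_zero, smul_eq_mul,
        smul_eq_mul, Ideal.mul_top] at hx
      rw [Submodule.Quotient.mk_eq_zero, smul_eq_mul, Ideal.mul_top]
      exact mem_map_C_of_monic_mul_mem _ hy hx
    refine ⟨(rs.map (algebraMap _ (Polynomial (MvPolynomial (Fin m) k))) ++ [y]).map e.symm,
      by simp [hlen], ?_, ?_⟩
    · intro r hr
      obtain ⟨s, hs, rfl⟩ := List.mem_map.1 hr
      rcases List.mem_append.1 hs with hs | hs
      · obtain ⟨t, ht, rfl⟩ := List.mem_map.1 hs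
        exact hmem t ht
      · rw [List.mem_singleton.1 hs]
        exact hyq
    · refine (AddEquiv.isWeaklyRegular_congr (e := e.symm.toAddEquiv) ?_).1 h1
      rw [List.forall₂_map_right_iff]
      refine List.forall₂_same.2 fun s _ x => ?_
      exact map_mul e.symm s x

theorem ringKrullDim_le_of_isIntegral (R S : Type*) [CommRing R] [CommRing S] [Algebra R S]
    [Algebra.IsIntegral R S] : ringKrullDim S ≤ ringKrullDim R :=
  Order.krullDim_le_of_strictMono
    (fun p => (⟨p.asIdeal.comap (algebraMap R S), inferInstance⟩ : PrimeSpectrum R))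
    fun _ _ hpq => Ideal.IsIntegral.comap_lt_comap hpq

/-- A ring that is finite and flat over a polynomial ring over a field is Cohen–Macaulay. -/
theorem isCohenMacaulay_of_finite_of_flat {k : Type*} [Field k] (m : ℕ) (S : Type*) [CommRing S]
    [Algebra (MvPolynomial (Fin m) k) S] [Module.Finite (MvPolynomial (Fin m) k) S]
    [Module.Flat (MvPolynomial (Fin m) k) S] : IsCohenMacaulay S := by
  have hS : IsNoetherianRing S :=
    IsNoetherianRing.of_finite (MvPolynomial (Fin m) k) S
  refine ⟨hS, fun p hp => ⟨inferInstance, ?_⟩⟩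
  have hq : (p.comap (algebraMap (MvPolynomial (Fin m) k) S)).IsMaximal :=
    Ideal.isMaximal_comap_of_isIntegral_of_isMaximal p
  obtain ⟨rs, hlen, hmem, hreg⟩ := exists_isWeaklyRegular_of_isMaximal m
    (p.comap (algebraMap (MvPolynomial (Fin m) k) S))
  have hmem' : ∀ r ∈ rs.map (algebraMap _ S), r ∈ p := by
    intro r hr
    obtain ⟨t, ht, rfl⟩ := List.mem_map.1 hr
    exact hmem t ht
  -- a regular sequence in the contraction of `p` stays regular by flatness; its length `m` is at most
  -- the dimension of the localization at `p`, which is at most `m` by integrality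
  have hreg' := IsWeaklyRegular.isRegular_of_isLocalization_of_mem (Localization.AtPrime p) p
    (hreg.of_flat (S := S)) hmem'
  refine ⟨_, ?_, hreg', le_antisymm ?_ ?_⟩
  · intro r hr
    obtain ⟨t, ht, rfl⟩ := List.mem_map.1 hr
    exact (IsLocalization.AtPrime.to_map_mem_maximal_iff _ p t).2 (hmem' t ht)
  · have h0 := ringKrullDim_add_length_eq_ringKrullDim_of_isRegular _ hreg'
    rw [← h0]
    have : Nontrivial (Localization.AtPrime p ⧸ Ideal.ofList ((rs.map (algebraMap _ S)).map
        (algebraMap S (Localization.AtPrime p)))) := by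
      refine Ideal.Quotient.nontrivial_iff.2 fun h => hreg'.2 ?_
      rw [h, Submodule.top_smul]
    exact le_add_of_nonneg_left ringKrullDim_nonneg_of_nontrivial
  · rw [List.length_map, List.length_map, hlen,
      IsLocalization.AtPrime.ringKrullDim_eq_height p (Localization.AtPrime p)]
    refine (Ideal.height_le_ringKrullDim_of_ne_top hp.ne_top).trans ?_
    refine (ringKrullDim_le_of_isIntegral (MvPolynomial (Fin m) k) S).trans ?_
    rw [MvPolynomial.ringKrullDim_of_isNoetherianRing]
    simp

end CohenMacaulayCriterion

/-! ### Quotients by a divisor of a monic polynomial -/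

section Hypersurface

open Polynomial in
/-- Let `A` be free over `T[w]` and let `h` divide in `A` a monic polynomial of `T[w]`.  Then
`A / h` is flat over `T`: multiplication by `h` is injective modulo every ideal of `T`. -/
theorem flat_of_surjective_of_monic {T A S : Type*} [CommRing T] [CommRing A] [CommRing S]
    [Algebra T[X] A] [Module.Free T[X] A] [Algebra T A] [IsScalarTower T T[X] A] [Algebra T S]
    (φ : A →ₐ[T] S) (hφ : Function.Surjective φ) (h : A) (hker : ∀ a, φ a = 0 ↔ h ∣ a)
    (N : T[X]) (hN : N.Monic) (hdvd : h ∣ algebraMap T[X] A N) : Module.Flat T S := by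
  classical
  have : Module.Flat T A := Module.Flat.trans T T[X] A
  refine Module.Flat.of_forall_isTrivialRelation fun {l f x} hx => ?_
  choose b hb using fun i => hφ (x i)
  obtain ⟨c, hc⟩ : h ∣ ∑ i, f i • b i := by
    rw [← hker, map_sum, ← hx]
    exact Finset.sum_congr rfl fun i _ => by rw [map_smul, hb]
  obtain ⟨h', hh'⟩ := hdvd
  -- the quotient `c` lies in the ideal generated by the coefficients `f_i`
  have hcmem : ∃ c' : Fin l → A, c = ∑ i, f i • c' i := by
    let J : Ideal T := Ideal.span (Set.range f)
    let B := Module.Free.chooseBasis T[X] A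
    have hNc : N • c = ∑ i, f i • (h' * b i) := by
      rw [Algebra.smul_def, hh', mul_comm h h', mul_assoc, ← hc, Finset.mul_sum]
      exact Finset.sum_congr rfl fun i _ => by rw [mul_smul_comm]
    have hcoord : ∀ s, B.repr c s ∈ J.map Polynomial.C := by
      intro s
      refine mem_map_C_of_monic_mul_mem J hN ?_
      have h1 := congr_arg (fun a => B.repr a s) hNc
      simp only [map_smul, Finsupp.smul_apply, smul_eq_mul, map_sum, Finsupp.finsetSum_apply] at h1
      rw [h1]
      refine sum_mem fun i _ => ?_
      have h2 : B.repr (f i • (h' * b i)) s = Polynomial.C (f i) * B.repr (h' * b i) s := by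
        rw [← IsScalarTower.algebraMap_smul T[X] (f i), map_smul]
        rfl
      rw [h2]
      exact Ideal.mul_mem_right _ _ (Ideal.mem_map_of_mem _ (Ideal.subset_span ⟨i, rfl⟩))
    have hcoord' : ∀ s, ∃ u : Fin l → T[X], ∑ i, u i * Polynomial.C (f i) = B.repr c s := by
      intro s
      have := hcoord s
      rw [Ideal.map_span, ← Set.range_comp] at this
      exact Ideal.mem_span_range_iff_exists_fun.1 this
    choose u hu using hcoord'
    refine ⟨fun i => ∑ s ∈ (B.repr c).support, u s i • B s, ?_⟩
    conv_lhs => rw [← B.linearCombination_repr c, Finsupp.linearCombination_apply, Finsupp.sum]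
    simp only [Finset.smul_sum]
    rw [Finset.sum_comm]
    refine Finset.sum_congr rfl fun s _ => ?_
    rw [← hu s, Finset.sum_smul]
    refine Finset.sum_congr rfl fun i _ => ?_
    rw [mul_comm, mul_smul]
    exact IsScalarTower.algebraMap_smul T[X] (f i) _
  obtain ⟨c', rfl⟩ := hcmem
  have h0 : ∑ i, f i • (b i - h * c' i) = 0 := by
    simp only [smul_sub, Finset.sum_sub_distrib]
    rw [hc, Finset.mul_sum, sub_eq_zero]
    exact Finset.sum_congr rfl fun i _ => by rw [mul_smul_comm]
  obtain ⟨κ, a, y, hy, ha⟩ := Module.Flat.isTrivialRelation_of_sum_smul_eq_zero (R := T) (M := A) h0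
  refine ⟨κ, a, fun j => φ (y j), fun i => ?_, ha⟩
  have := congr_arg φ (hy i)
  rw [map_sub, (hker _).2 (dvd_mul_right h (c' i)), sub_zero, hb, map_sum] at this
  rw [this]
  exact Finset.sum_congr rfl fun j _ => map_smul φ _ _

open Polynomial in
/-- Let `A` be finite over `T[w]` and let `h` divide in `A` a monic polynomial `N` of `T[w]`.  Then
`A / h` is finite over `T`: division by `N` bounds the powers of `w` that are needed. -/
theorem finite_of_surjective_of_monic {T A S : Type*} [CommRing T] [CommRing A] [CommRing S]
    [Algebra T[X] A] [Module.Finite T[X] A] [Algebra T A] [IsScalarTower T T[X] A] [Algebra T S]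
    (φ : A →ₐ[T] S) (hφ : Function.Surjective φ) (h : A) (hker : ∀ a, φ a = 0 ↔ h ∣ a)
    (N : T[X]) (hN : N.Monic) (hdvd : h ∣ algebraMap T[X] A N) : Module.Finite T S := by
  classical
  obtain ⟨s, hs⟩ := Module.Finite.fg_top (R := T[X]) (M := A)
  have hN0 : φ (algebraMap T[X] A N) = 0 := (hker _).2 hdvd
  let M : Submodule T S := Submodule.span T
    ((fun p : ℕ × A => φ (algebraMap T[X] A (Polynomial.X ^ p.1) * p.2)) ''
      ((Finset.range N.natDegree ×ˢ s : Finset (ℕ × A)) : Set (ℕ × A)))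
  have key : ∀ (p : T[X]) (a : A), a ∈ s → φ (p • a) ∈ M := by
    intro p a ha
    have h1 : φ (p • a) = φ ((p %ₘ N) • a) := by
      conv_lhs => rw [← Polynomial.modByMonic_add_div p N]
      rw [add_smul, map_add, mul_smul, Algebra.smul_def N, map_mul, hN0, zero_mul, add_zero]
    rcases subsingleton_or_nontrivial T with hT | hT
    · have : Subsingleton S := Module.subsingleton T S
      rw [Subsingleton.elim (φ (p • a)) 0]
      exact zero_mem _
    rw [h1, (p %ₘ N).as_sum_range_C_mul_X_pow, Finset.sum_smul, map_sum]
    refine sum_mem fun i hi => ?_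
    by_cases hiN : i < N.natDegree
    · have h2 : φ ((Polynomial.C ((p %ₘ N).coeff i) * Polynomial.X ^ i) • a) =
          (p %ₘ N).coeff i • φ (algebraMap T[X] A (Polynomial.X ^ i) * a) := by
        rw [mul_smul, Algebra.smul_def (Polynomial.X ^ i : T[X]) a, ← map_smul]
        congr 1
        exact IsScalarTower.algebraMap_smul T[X] _ _
      rw [h2]
      exact M.smul_mem _ (Submodule.subset_span ⟨(i, a), by simp [hiN, ha], rfl⟩)
    · have h3 : (p %ₘ N).coeff i = 0 := by
        refine Polynomial.coeff_eq_zero_of_degree_lt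
          ((Polynomial.degree_modByMonic_lt p hN).trans_le ?_)
        rw [Polynomial.degree_eq_natDegree hN.ne_zero]
        exact_mod_cast not_lt.1 hiN
      rw [h3, map_zero, zero_mul, zero_smul, map_zero]
      exact zero_mem _
  have hM : M = ⊤ := by
    rw [eq_top_iff]
    rintro x -
    obtain ⟨a, rfl⟩ := hφ x
    have ha : a ∈ Submodule.span T[X] (s : Set A) := hs ▸ Submodule.mem_top
    induction ha using Submodule.closure_induction with
    | zero => rw [map_zero]; exact zero_mem _
    | add x y _ _ hx hy => rw [map_add]; exact add_mem hx hy
    | smul_mem p a ha => exact key p a ha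
  exact ⟨hM ▸ Submodule.fg_span ((Finset.finite_toSet _).image _)⟩

end Hypersurface

/-! ### Nagata's change of variables -/

section Nagata

variable {k : Type*} [Field k] {m : ℕ}

/-- The substitution `x_i ↦ x_i + c x_0 ^ (D ^ i)` for `i ≠ 0`, `x_0 ↦ x_0`. -/
noncomputable def nagataHom (D : ℕ) (c : k) :
    MvPolynomial (Fin (m + 1)) k →ₐ[k] MvPolynomial (Fin (m + 1)) k :=
  aeval fun i => if i = 0 then X 0 else X i + c • X 0 ^ D ^ (i : ℕ)

theorem nagataHom_comp_neg (D : ℕ) (c : k) :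
    (nagataHom (m := m) D c).comp (nagataHom D (-c)) = AlgHom.id k _ := by
  refine MvPolynomial.algHom_ext fun i => ?_
  cases i using Fin.cases <;> simp [nagataHom]

/-- The change of variables `x_i ↦ x_i + x_0 ^ (D ^ i)`, with values in polynomials in `x_0`. -/
noncomputable def nagataEquiv (D : ℕ) :
    MvPolynomial (Fin (m + 1)) k ≃ₐ[k] Polynomial (MvPolynomial (Fin m) k) :=
  (AlgEquiv.ofAlgHom (nagataHom D 1) (nagataHom D (-1)) (nagataHom_comp_neg D 1)
    (by simpa using nagataHom_comp_neg (m := m) D (-1 : k))).trans (finSuccEquiv k m)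

theorem nagataEquiv_apply (D : ℕ) (p : MvPolynomial (Fin (m + 1)) k) :
    nagataEquiv D p = finSuccEquiv k m (nagataHom D 1 p) := rfl

theorem nagataEquiv_X_zero (D : ℕ) :
    nagataEquiv D (X 0 : MvPolynomial (Fin (m + 1)) k) = Polynomial.X := by
  simp [nagataEquiv_apply, nagataHom, finSuccEquiv_X_zero]

theorem nagataEquiv_X_succ (D : ℕ) (i : Fin m) :
    nagataEquiv D (X i.succ : MvPolynomial (Fin (m + 1)) k) =
      Polynomial.X ^ D ^ ((i : ℕ) + 1) + Polynomial.C (X i) := by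
  simp [nagataEquiv_apply, nagataHom, finSuccEquiv_X_zero, finSuccEquiv_X_succ, add_comm]

theorem nagataEquiv_X (D : ℕ) (hD : 0 < D) (i : Fin (m + 1)) :
    (nagataEquiv D (X i : MvPolynomial (Fin (m + 1)) k)).Monic ∧
      (nagataEquiv D (X i : MvPolynomial (Fin (m + 1)) k)).natDegree = D ^ (i : ℕ) := by
  have hpos : ∀ j, D ^ j ≠ 0 := fun j => (pow_pos hD j).ne'
  cases i using Fin.cases with
  | zero =>
    rw [nagataEquiv_X_zero]
    exact ⟨Polynomial.monic_X, by simp⟩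
  | succ i =>
    rw [nagataEquiv_X_succ]
    exact ⟨Polynomial.monic_X_pow_add_C _ (hpos _), Polynomial.natDegree_X_pow_add_C⟩

theorem nagataEquiv_monomial (D : ℕ) (hD : 0 < D) (v : Fin (m + 1) →₀ ℕ) {a : k} (ha : a ≠ 0) :
    (nagataEquiv D (monomial v a)).leadingCoeff = C a ∧
      (nagataEquiv D (monomial v a)).natDegree = ∑ i : Fin (m + 1), D ^ (i : ℕ) * v i := by
  have hC : nagataEquiv D (C a : MvPolynomial (Fin (m + 1)) k) = Polynomial.C (C a) := by
    simp [nagataEquiv_apply, nagataHom, finSuccEquiv_apply]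
  have hmonic : ∀ i ∈ Finset.univ,
      (nagataEquiv D (X i : MvPolynomial (Fin (m + 1)) k) ^ v i).Monic :=
    fun i _ => (nagataEquiv_X D hD i).1.pow _
  have hprod := Polynomial.monic_prod_of_monic Finset.univ _ hmonic
  have hmon : nagataEquiv D (monomial v a) = Polynomial.C (C a) *
      ∏ i, nagataEquiv D (X i : MvPolynomial (Fin (m + 1)) k) ^ v i := by
    rw [monomial_eq, Finsupp.prod_fintype _ _ (fun _ => pow_zero _), map_mul, hC, map_prod]
    simp only [map_pow]
  have ha' : (C a : MvPolynomial (Fin m) k) ≠ 0 := by simpa using ha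
  rw [hmon]
  constructor
  · rw [Polynomial.leadingCoeff_mul_monic hprod, Polynomial.leadingCoeff_C]
  · rw [Polynomial.natDegree_C_mul ha', Polynomial.natDegree_prod_of_monic _ _ hmonic]
    refine Finset.sum_congr rfl fun i _ => ?_
    rw [(nagataEquiv_X D hD i).1.natDegree_pow, (nagataEquiv_X D hD i).2, mul_comm]

/-- Different vectors of digits in base `D` give different numbers. -/
theorem sum_pow_mul_ne {D : ℕ} (hD : 1 < D) {v w : Fin (m + 1) →₀ ℕ} (hv : ∀ i, v i < D)
    (hw : ∀ i, w i < D) (hvw : v ≠ w) :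
    ∑ i : Fin (m + 1), D ^ (i : ℕ) * v i ≠ ∑ i : Fin (m + 1), D ^ (i : ℕ) * w i := by
  intro h
  refine hvw (Finsupp.ext (congrFun (List.ofFn_inj.mp ?_)))
  refine Nat.ofDigits_inj_of_len_eq hD (by simp) (by simpa only [List.forall_mem_ofFn_iff] using hv)
    (by simpa only [List.forall_mem_ofFn_iff] using hw) ?_
  simpa only [Nat.ofDigits_eq_sum_mapIdx, List.mapIdx_eq_ofFn, List.get_ofFn, List.length_ofFn,
    Fin.val_cast, mul_comm, List.sum_ofFn] using! h

/-- Nagata's change of variables makes every nonzero polynomial monic in one variable, up to a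
constant: for large `D`, its monomials get different degrees in `x_0`. -/
theorem exists_algEquiv_isUnit_leadingCoeff {N : MvPolynomial (Fin (m + 1)) k} (hN : N ≠ 0) :
    ∃ e : MvPolynomial (Fin (m + 1)) k ≃ₐ[k] Polynomial (MvPolynomial (Fin m) k),
      IsUnit (e N).leadingCoeff := by
  classical
  set D := 2 + N.totalDegree with hD
  have hlt : ∀ v ∈ N.support, ∀ i, v i < D := fun v hv i =>
    lt_of_le_of_lt ((monomial_le_degreeOf i hv).trans (degreeOf_le_totalDegree N i)) (by omega)
  refine ⟨nagataEquiv D, ?_⟩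
  obtain ⟨v, hv, hmax⟩ := Finset.exists_max_image N.support
    (fun v => ∑ i : Fin (m + 1), D ^ (i : ℕ) * v i) (support_nonempty.2 hN)
  have hmono := fun w (hw : w ∈ N.support) =>
    nagataEquiv_monomial D (by omega) w (mem_support_iff.1 hw)
  have hne : nagataEquiv D (monomial v (coeff v N)) ≠ 0 := by
    intro h
    have := (hmono v hv).1
    rw [h, Polynomial.leadingCoeff_zero] at this
    exact mem_support_iff.1 hv (by simpa using this.symm)
  have hdeg : (∑ w ∈ N.support \ {v}, nagataEquiv D (monomial w (coeff w N))).degree <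
      (nagataEquiv D (monomial v (coeff v N))).degree := by
    refine lt_of_le_of_lt (Polynomial.degree_sum_le _ _) ?_
    rw [Finset.sup_lt_iff (bot_lt_iff_ne_bot.2 fun h => hne (Polynomial.degree_eq_bot.1 h))]
    intro w hw
    obtain ⟨hw, hwv⟩ := Finset.mem_sdiff.1 hw
    refine Polynomial.degree_lt_degree ?_
    rw [(hmono w hw).2, (hmono v hv).2]
    exact lt_of_le_of_ne (hmax w hw) (sum_pow_mul_ne (by omega) (hlt w hw) (hlt v hv)
      fun h => hwv (Finset.mem_singleton.2 h))
  have hsum : nagataEquiv D N = (∑ w ∈ N.support \ {v}, nagataEquiv D (monomial w (coeff w N))) +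
      nagataEquiv D (monomial v (coeff v N)) := by
    conv_lhs => rw [← N.support_sum_monomial_coeff]
    rw [Finset.sum_eq_add_sum_sdiff_singleton_of_mem hv, map_add, map_sum, add_comm]
  rw [hsum, Polynomial.leadingCoeff_add_of_degree_lt hdeg, (hmono v hv).1]
  exact (mem_support_iff.1 hv).isUnit.map C

end Nagata

/-! ### Hypersurfaces in domains free over a polynomial ring -/

section HypersurfaceCohenMacaulay

/-- If the domain `A` is finite and free over a polynomial ring over a field, then `A / h` is
Cohen–Macaulay for every `h ≠ 0`. -/
theorem isCohenMacaulay_of_surjective {k : Type*} [Field k] {m : ℕ} {A S : Type*} [CommRing A]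
    [IsDomain A] [CommRing S] [Algebra (MvPolynomial (Fin (m + 1)) k) A]
    [Module.Finite (MvPolynomial (Fin (m + 1)) k) A] [Module.Free (MvPolynomial (Fin (m + 1)) k) A]
    (φ : A →+* S) (hφ : Function.Surjective φ) {h : A} (h0 : h ≠ 0)
    (hker : ∀ a, φ a = 0 ↔ h ∣ a) : IsCohenMacaulay S := by
  obtain ⟨N, hN, hdvd⟩ := ((Algebra.IsIntegral.isIntegral
    (R := MvPolynomial (Fin (m + 1)) k) h).isAlgebraic).exists_nonzero_dvd
      (mem_nonZeroDivisors_of_ne_zero h0)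
  obtain ⟨e, he⟩ := exists_algEquiv_isUnit_leadingCoeff hN
  -- `A` becomes an algebra over `T[w]` through the change of variables `e`
  let T := MvPolynomial (Fin m) k
  let ε : MvPolynomial (Fin (m + 1)) k →+* Polynomial T := e.toRingEquiv
  let ε' : Polynomial T →+* MvPolynomial (Fin (m + 1)) k := e.toRingEquiv.symm
  have hinv : RingHomInvPair ε ε' := RingHomInvPair.of_ringEquiv e.toRingEquiv
  have hinv' : RingHomInvPair ε' ε := hinv.symm
  let alg1 : Algebra (Polynomial T) A :=
    ((algebraMap (MvPolynomial (Fin (m + 1)) k) A).comp ε').toAlgebra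
  let alg2 : Algebra T A := ((algebraMap (Polynomial T) A).comp Polynomial.C).toAlgebra
  let alg3 : Algebra T S := (φ.comp (algebraMap T A)).toAlgebra
  have htower : IsScalarTower T (Polynomial T) A := IsScalarTower.of_algebraMap_eq' rfl
  let L : A ≃ₛₗ[ε] A :=
    { AddEquiv.refl A with
      map_smul' := fun r a => by
        simp only [Algebra.smul_def]
        change _ = algebraMap _ A (e.symm (e r)) * a
        rw [e.symm_apply_apply]
        rfl }
  have hfin : Module.Finite (Polynomial T) A :=
    Module.Finite.of_surjective L.toLinearMap L.surjective
  have hfree : Module.Free (Polynomial T) A := Module.Free.of_equiv L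
  let ψ : A →ₐ[T] S := { φ with commutes' := fun _ => rfl }
  obtain ⟨u, hu⟩ := he
  have hmonic : (Polynomial.C (↑u⁻¹ : T) * e N).Monic := by
    rw [Polynomial.Monic, Polynomial.leadingCoeff_C_mul_of_isUnit u⁻¹.isUnit, ← hu]
    exact u.inv_mul
  have hdvd' : h ∣ algebraMap (Polynomial T) A (Polynomial.C (↑u⁻¹ : T) * e N) := by
    rw [map_mul]
    refine Dvd.dvd.mul_left ?_ _
    change h ∣ algebraMap _ A (e.symm (e N))
    rwa [e.symm_apply_apply]
  have : Module.Finite T S := finite_of_surjective_of_monic ψ hφ h hker _ hmonic hdvd'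
  have : Module.Flat T S := flat_of_surjective_of_monic ψ hφ h hker _ hmonic hdvd'
  exact isCohenMacaulay_of_finite_of_flat (k := k) m S

end HypersurfaceCohenMacaulay

/-! ### Generators of the toric ring over its parameters -/

section Spanning

/-- Let the `2 × n` matrix with rows `x_0, …, x_{n-1}` and `y_0, …, y_{n-1}` have vanishing minors,
and let `x_0`, the differences `y_j - x_{j+1}` and `y_{n-1}` be scalars.  Then the span of
`1, x_0, …, x_{n-1}` is closed under multiplication. -/
theorem mul_mem_span_of_minors {P A : Type*} [CommRing P] [CommRing A] [Algebra P A] {n : ℕ}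
    (x y : ℕ → A) (θ : ℕ → P) (hx0 : x 0 = algebraMap P A (θ 0))
    (hy : ∀ j < n, y j = algebraMap P A (θ (j + 1)) + x (j + 1)) (hxn : ∀ i, n ≤ i → x i = 0)
    (hxy : ∀ i < n, ∀ j < n, x i * y j = x j * y i) {a b : A}
    (ha : a ∈ Submodule.span P (insert 1 (Set.range x)))
    (hb : b ∈ Submodule.span P (insert 1 (Set.range x))) :
    a * b ∈ Submodule.span P (insert 1 (Set.range x)) := by
  set M := Submodule.span P (insert 1 (Set.range x)) with hM
  have hxM : ∀ i, x i ∈ M := fun i => Submodule.subset_span (Or.inr ⟨i, rfl⟩)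
  -- modulo the span, `x_i x_{j+1}` agrees with `x_{i+1} x_j`, so the second index can be lowered
  have hxx : ∀ j i, x i * x j ∈ M := by
    intro j
    induction j with
    | zero =>
      intro i
      rw [hx0, mul_comm, ← Algebra.smul_def]
      exact M.smul_mem _ (hxM i)
    | succ j ih =>
      intro i
      by_cases hi : i < n
      · by_cases hj : j < n
        · have h := hxy i hi j hj
          rw [hy i hi, hy j hj] at h
          have h' : x i * x (j + 1) = x (i + 1) * x j + θ (i + 1) • x j - θ (j + 1) • x i := by
            rw [Algebra.smul_def, Algebra.smul_def]
            linear_combination h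
          rw [h']
          exact sub_mem (add_mem (ih _) (M.smul_mem _ (hxM _))) (M.smul_mem _ (hxM _))
        · rw [hxn (j + 1) (by omega), mul_zero]
          exact zero_mem _
      · rw [hxn i (by omega), zero_mul]
        exact zero_mem _
  have hmul : M * M ≤ M := by
    rw [hM, Submodule.span_mul_span, Submodule.span_le]
    rintro _ ⟨a, ha, b, hb, rfl⟩
    rcases ha with rfl | ⟨i, rfl⟩ <;> rcases hb with rfl | ⟨j, rfl⟩
    · exact Submodule.subset_span (Or.inl (one_mul 1))
    · simp only [one_mul]
      exact hxM j
    · simp only [mul_one]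
      exact hxM i
    · exact hxx j i
  exact hmul (Submodule.mul_mem_mul ha hb)

end Spanning

/-! ### Independence by degrees modulo `n` -/

section Independence

open Polynomial in
/-- If `e_0, …, e_{n-1}` have degrees `0, …, n - 1` and `w` has degree `n`, then the `e_i` are
independent over the polynomials in `w`: the degrees of the terms differ modulo `n`. -/
theorem eq_zero_of_sum_comp_mul_eq_zero {K : Type*} [CommRing K] [IsDomain K] {n : ℕ}
    (e : Fin n → K[X]) (he : ∀ i, (e i).natDegree = i) (he0 : ∀ i, e i ≠ 0) (w : K[X])
    (hw : w.natDegree = n) (a : Fin n → K[X]) (h : ∑ i, (a i).comp w * e i = 0) (i : Fin n) :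
    a i = 0 := by
  have hn : 0 < n := Fin.pos i
  have hcomp : ∀ j, (a j).comp w = 0 → a j = 0 := by
    intro j hj
    rcases Polynomial.comp_eq_zero_iff.1 hj with h | ⟨-, h⟩
    · exact h
    · rw [h, Polynomial.natDegree_C] at hw
      omega
  have hdeg := Polynomial.degree_sum_eq_of_disjoint (fun j => (a j).comp w * e j) Finset.univ (by
    rintro i ⟨-, hi⟩ j ⟨-, hj⟩ hij hd
    simp only [Function.comp_apply, Polynomial.degree_eq_natDegree hi,
      Polynomial.degree_eq_natDegree hj, Nat.cast_inj] at hd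
    rw [Polynomial.natDegree_mul (left_ne_zero_of_mul hi) (he0 i),
      Polynomial.natDegree_mul (left_ne_zero_of_mul hj) (he0 j), Polynomial.natDegree_comp,
      Polynomial.natDegree_comp, hw, he, he] at hd
    have := congr_arg (· % n) hd
    simp only [Nat.mul_add_mod_self_right, Nat.mod_eq_of_lt i.2, Nat.mod_eq_of_lt j.2] at this
    exact hij (Fin.ext this))
  rw [h, Polynomial.degree_zero] at hdeg
  have := (Finset.sup_eq_bot_iff _ _).1 hdeg.symm i (Finset.mem_univ i)
  rw [Polynomial.degree_eq_bot] at this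
  exact hcomp i ((mul_eq_zero.1 this).resolve_right (he0 i))

/-- The images of `x_0, x_1, …` in `K[λ]`, where `y_j ↦ λ x_j` and `y_j - x_{j+1} ↦ t_{j+1}`. -/
noncomputable def toricRow {K : Type*} [CommRing K] (t : ℕ → K) : ℕ → Polynomial K
  | 0 => Polynomial.C (t 0)
  | j + 1 => Polynomial.X * toricRow t j - Polynomial.C (t (j + 1))

theorem toricRow_ne_zero_and_natDegree {K : Type*} [CommRing K] [IsDomain K] (t : ℕ → K)
    (ht : t 0 ≠ 0) (j : ℕ) : toricRow t j ≠ 0 ∧ (toricRow t j).natDegree = j := by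
  induction j with
  | zero => simp [toricRow, ht]
  | succ j ih =>
    have : (toricRow t (j + 1)).natDegree = j + 1 := by
      rw [toricRow, Polynomial.natDegree_sub_C, Polynomial.natDegree_X_mul ih.1, ih.2]
    refine ⟨fun h => ?_, this⟩
    rw [h, Polynomial.natDegree_zero] at this
    omega

end Independence

/-! ### The toric ring is free over its parameters -/

section ToricRing

variable (k : Type*) [Field k] (n : ℕ)

/-- The coordinate ring `B / I_2(ψ)`, as the image of the toric map. -/
noncomputable abbrev ToricRing : Type _ := (toricMap k n le_rfl).range

/-- The projection of `B` onto the toric ring. -/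
noncomputable abbrev toToricRing : BigRing k n →ₐ[k] ToricRing k n :=
  (toricMap k n le_rfl).rangeRestrict

/-- The row `x`, extended by zero. -/
noncomputable def xSeq (i : ℕ) : BigRing k n := if h : i < n then xRow k n ⟨i, h⟩ else 0

/-- The row `y`, followed by `y_{n+1}` and zeros. -/
noncomputable def ySeq (i : ℕ) : BigRing k n := if h : i < n + 1 then X ⟨i, h⟩ else 0

/-- The linear forms `x_0, y_0 - x_1, …, y_{n-2} - x_{n-1}, y_{n-1}` (indices starting at `0`). -/
noncomputable def paramSeq : ℕ → BigRing k n
  | 0 => xSeq k n 0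
  | j + 1 => ySeq k n j - xSeq k n (j + 1)

/-- A system of parameters of the toric ring: the forms of `paramSeq`, the last one moved to
the front, and `y_{n+1}`. -/
noncomputable def param : Fin (n + 2) → BigRing k n :=
  Fin.cons (paramSeq k n n) fun i : Fin (n + 1) =>
    if (i : ℕ) < n then paramSeq k n i else X (Fin.last n)

/-- The map from the polynomial ring in the parameters to the toric ring. -/
noncomputable def paramMap : MvPolynomial (Fin (n + 2)) k →ₐ[k] ToricRing k n :=
  aeval fun i => toToricRing k n (param k n i)

variable {k n}

theorem paramMap_X (i : Fin (n + 2)) : paramMap k n (X i) = toToricRing k n (param k n i) :=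
  aeval_X _ _

theorem exists_paramMap_eq {i : ℕ} (hi : i ≤ n) :
    ∃ p, paramMap k n p = toToricRing k n (paramSeq k n i) := by
  rcases hi.eq_or_lt with rfl | h
  · exact ⟨X 0, by rw [paramMap_X]; rfl⟩
  · refine ⟨X (Fin.succ ⟨i, by omega⟩), ?_⟩
    rw [paramMap_X, param, Fin.cons_succ, if_pos h]

theorem exists_paramMap_eq_X_last : ∃ p, paramMap k n p = toToricRing k n (X (Fin.last n)) := by
  refine ⟨X (Fin.last n).succ, ?_⟩
  rw [paramMap_X, param, Fin.cons_succ, if_neg (by simp)]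

theorem toToricRing_minor (i j : Fin n) : toToricRing k n (xRow k n i) *
    toToricRing k n (yRow k n j) = toToricRing k n (xRow k n j) * toToricRing k n (yRow k n i) := by
  rw [← sub_eq_zero, ← map_mul, ← map_mul, ← map_sub]
  exact Subtype.ext (toricMap_eq_zero_of_mem k n le_rfl
    (Ideal.subset_span ⟨i, j, i.2, j.2, rfl⟩))

/-- The variables of the coefficient ring `k[t_0, …, t_{n-1}, y_{n+1}]`, extended by zero. -/
noncomputable def paramVar (k : Type*) [Field k] (n : ℕ) (j : ℕ) : MvPolynomial (Fin (n + 1)) k :=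
  if h : j < n + 1 then X ⟨j, h⟩ else 0

/-- The map from the toric ring to `k[t_0, …, t_{n-1}, y_{n+1}][λ]` that detects independence over
the parameters. -/
noncomputable def toricEval (k : Type*) [Field k] (n : ℕ) :
    MvPolynomial (Option (Fin (n + 1) ⊕ Fin n)) k →ₐ[k]
      Polynomial (MvPolynomial (Fin (n + 1)) k) :=
  aeval fun c => c.elim Polynomial.X
    (Sum.elim (fun _ => Polynomial.C (X (Fin.last n))) fun i => toricRow (paramVar k n) i)

theorem toricEval_xRow (i : Fin n) :
    toricEval k n (toricMap k n le_rfl (xRow k n i)) = toricRow (paramVar k n) i := by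
  rw [xRow, toricMap_x, toricEval, aeval_X]
  rfl

theorem toricEval_yRow (i : Fin n) : toricEval k n (toricMap k n le_rfl (yRow k n i)) =
    Polynomial.X * toricRow (paramVar k n) i := by
  rw [yRow, toricMap_y_of_lt k n le_rfl i i.2, map_mul, toricEval, aeval_X, aeval_X]
  rfl

theorem toricEval_paramSeq {i : ℕ} (hi : i < n) :
    toricEval k n (toricMap k n le_rfl (paramSeq k n i)) = Polynomial.C (paramVar k n i) := by
  rcases i with _ | i
  · rw [paramSeq, xSeq, dif_pos hi, toricEval_xRow]
    rfl
  · have hy : ySeq k n i = yRow k n ⟨i, by omega⟩ := by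
      rw [ySeq, dif_pos (by omega)]
      rfl
    rw [paramSeq, xSeq, dif_pos hi, hy, map_sub, map_sub, toricEval_xRow, toricEval_yRow]
    simp [toricRow]

theorem toricEval_paramSeq_last (hn : 1 ≤ n) :
    toricEval k n (toricMap k n le_rfl (paramSeq k n n)) =
      Polynomial.X * toricRow (paramVar k n) (n - 1) := by
  obtain ⟨m, rfl⟩ : ∃ m, n = m + 1 := ⟨n - 1, by omega⟩
  have hy : ySeq k (m + 1) m = yRow k (m + 1) ⟨m, by omega⟩ := by
    rw [ySeq, dif_pos (by omega)]
    rfl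
  rw [paramSeq, xSeq, dif_neg (by omega), sub_zero, hy, toricEval_yRow]
  rfl

theorem toricEval_paramMap (hn : 1 ≤ n) (p : MvPolynomial (Fin (n + 2)) k) :
    toricEval k n (paramMap k n p) =
      (finSuccEquiv k (n + 1) p).comp (Polynomial.X * toricRow (paramVar k n) (n - 1)) := by
  let ev : Polynomial (MvPolynomial (Fin (n + 1)) k) →ₐ[k]
      Polynomial (MvPolynomial (Fin (n + 1)) k) :=
    (Polynomial.aeval (R := MvPolynomial (Fin (n + 1)) k)
      (Polynomial.X * toricRow (paramVar k n) (n - 1))).restrictScalars k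
  have h : ((toricEval k n).comp (toricMap k n le_rfl).range.val).comp (paramMap k n) =
      ev.comp (finSuccEquiv k (n + 1)).toAlgHom := by
    refine MvPolynomial.algHom_ext fun i => ?_
    have h1 : (((toricEval k n).comp (toricMap k n le_rfl).range.val).comp (paramMap k n)) (X i) =
        toricEval k n (toricMap k n le_rfl (param k n i)) := by
      rw [AlgHom.comp_apply, paramMap_X]
      rfl
    rw [h1]
    cases i using Fin.cases with
    | zero =>
      rw [param, Fin.cons_zero, toricEval_paramSeq_last hn]
      simp [ev, finSuccEquiv_X_zero]
    | succ i =>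
      rw [param, Fin.cons_succ]
      have h2 : (ev.comp (finSuccEquiv k (n + 1)).toAlgHom) (X i.succ) = Polynomial.C (X i) := by
        simp [ev, finSuccEquiv_X_succ]
      rw [h2]
      split_ifs with hi
      · rw [toricEval_paramSeq hi, paramVar, dif_pos i.2]
      · have hi' : i = Fin.last n := by
          ext
          simp
          omega
        rw [toricMap_y_of_le k n le_rfl (Fin.last n) (by simp), toricEval, aeval_X, hi']
        rfl
  exact DFunLike.congr_fun h p

/-- The toric ring is free over the polynomial ring in its parameters, with basis
`1, x_1, …, x_{n-1}` (indices starting at `0`). -/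
theorem exists_algebra_toricRing_free (hn : 1 ≤ n) :
    ∃ _ : Algebra (MvPolynomial (Fin (n + 2)) k) (ToricRing k n),
      Module.Finite (MvPolynomial (Fin (n + 2)) k) (ToricRing k n) ∧
        Module.Free (MvPolynomial (Fin (n + 2)) k) (ToricRing k n) := by
  classical
  let P := MvPolynomial (Fin (n + 2)) k
  let alg : Algebra P (ToricRing k n) := (paramMap k n).toRingHom.toAlgebra
  have halg : ∀ p, algebraMap P (ToricRing k n) p = paramMap k n p := fun _ => rfl
  let e : Fin n → ToricRing k n := fun i => if (i : ℕ) = 0 then 1 else toToricRing k n (xRow k n i)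
  have hli : LinearIndependent P e := by
    rw [Fintype.linearIndependent_iff]
    intro a ha i
    have ht : paramVar k n 0 ≠ 0 := by
      rw [paramVar, dif_pos (by omega)]
      exact X_ne_zero _
    have hξ := toricRow_ne_zero_and_natDegree (paramVar k n) ht
    have h0 := congr_arg (fun z : ToricRing k n => toricEval k n z) ha
    have h1 : ∑ i, (finSuccEquiv k (n + 1) (a i)).comp
        (Polynomial.X * toricRow (paramVar k n) (n - 1)) * toricEval k n (e i) = 0 := by
      refine Eq.trans (Finset.sum_congr rfl fun i _ => ?_)
        ((map_sum ((toricEval k n).comp (toricMap k n le_rfl).range.val) _ _).symm.trans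
          (h0.trans (map_zero _)))
      rw [Algebra.smul_def, map_mul, ← toricEval_paramMap hn]
      rfl
    have he : ∀ i, toricEval k n (e i) ≠ 0 ∧ (toricEval k n (e i)).natDegree = i := by
      intro i
      by_cases hi : (i : ℕ) = 0
      · have : toricEval k n (e i) = 1 := by
          simp [e, hi]
        rw [this, hi]
        simp
      · have : toricEval k n (e i) = toricRow (paramVar k n) i := by
          simp only [e, if_neg hi]
          exact toricEval_xRow i
        rw [this]
        exact hξ i
    have := eq_zero_of_sum_comp_mul_eq_zero _ (fun i => (he i).2) (fun i => (he i).1)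
      (Polynomial.X * toricRow (paramVar k n) (n - 1)) (by
        rw [Polynomial.natDegree_X_mul (hξ _).1, (hξ _).2]
        omega) _ h1 i
    exact (map_eq_zero_iff _ (finSuccEquiv k (n + 1)).injective).1 this
  have hspan : ⊤ ≤ Submodule.span P (Set.range e) := by
    let x : ℕ → ToricRing k n := fun i => toToricRing k n (xSeq k n i)
    let y : ℕ → ToricRing k n := fun i => toToricRing k n (ySeq k n i)
    have hθ : ∀ i, ∃ p : P, i ≤ n → paramMap k n p = toToricRing k n (paramSeq k n i) := by
      intro i
      by_cases hi : i ≤ n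
      · obtain ⟨p, hp⟩ := exists_paramMap_eq (k := k) hi
        exact ⟨p, fun _ => hp⟩
      · exact ⟨0, fun h => absurd h hi⟩
    choose θ hθ using hθ
    have hx0 : x 0 = algebraMap P _ (θ 0) := by
      rw [halg, hθ 0 (by omega)]
      rfl
    have hy : ∀ j < n, y j = algebraMap P _ (θ (j + 1)) + x (j + 1) := by
      intro j hj
      rw [halg, hθ (j + 1) (by omega), paramSeq, map_sub, sub_add_cancel]
    have hxn : ∀ i, n ≤ i → x i = 0 := by
      intro i hi
      simp only [x, xSeq, dif_neg hi.not_gt, map_zero]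
    have hxR : ∀ i (hi : i < n), x i = toToricRing k n (xRow k n ⟨i, hi⟩) := by
      intro i hi
      simp only [x, xSeq, dif_pos hi]
    have hyR : ∀ i (hi : i < n), y i = toToricRing k n (yRow k n ⟨i, hi⟩) := by
      intro i hi
      simp only [y, ySeq, dif_pos (show i < n + 1 by omega)]
      rfl
    have hxy : ∀ i < n, ∀ j < n, x i * y j = x j * y i := by
      intro i hi j hj
      rw [hxR i hi, hxR j hj, hyR i hi, hyR j hj]
      exact toToricRing_minor _ _
    set M := Submodule.span P (insert 1 (Set.range x)) with hM
    have hone : (1 : ToricRing k n) ∈ M := Submodule.subset_span (Or.inl rfl)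
    have hscal : ∀ p : P, paramMap k n p ∈ M := by
      intro p
      rw [← halg, Algebra.algebraMap_eq_smul_one]
      exact M.smul_mem _ hone
    have hxM : ∀ i, x i ∈ M := fun i => Submodule.subset_span (Or.inr ⟨i, rfl⟩)
    have htop : ∀ q : MvPolynomial (Fin (n + 1) ⊕ Fin n) k,
        toToricRing k n (bigRingEquiv k n q) ∈ M := by
      intro q
      induction q using MvPolynomial.induction_on with
      | C r =>
        have : toToricRing k n (bigRingEquiv k n (C r)) = paramMap k n (C r) := by
          rw [← algebraMap_eq, AlgEquiv.commutes, AlgHom.commutes, ← algebraMap_eq,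
            AlgHom.commutes]
        rw [this]
        exact hscal _
      | add p q hp hq =>
        rw [map_add, map_add]
        exact add_mem hp hq
      | mul_X p c hp =>
        rw [map_mul, map_mul]
        refine mul_mem_span_of_minors x y θ hx0 hy hxn hxy hp ?_
        rcases c with j | i
        · rw [bigRingEquiv, sumAlgEquiv_X_inl]
          cases j using Fin.lastCases with
          | last =>
            obtain ⟨p, hp⟩ := exists_paramMap_eq_X_last (k := k) (n := n)
            rw [← hp]
            exact hscal p
          | cast j =>
            have := hyR j j.2
            rw [hy j j.2, halg] at this
            exact this ▸ add_mem (hscal _) (hxM _)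
        · rw [bigRingEquiv, sumAlgEquiv_X_inr]
          exact hxR i i.2 ▸ hxM i
    have hMe : M ≤ Submodule.span P (Set.range e) := by
      have h1 : (1 : ToricRing k n) ∈ Submodule.span P (Set.range e) :=
        Submodule.subset_span ⟨⟨0, by omega⟩, if_pos rfl⟩
      rw [hM, Submodule.span_le]
      rintro z (rfl | ⟨i, rfl⟩)
      · exact h1
      · rcases Nat.eq_zero_or_pos i with rfl | hi0
        · rw [hx0, Algebra.algebraMap_eq_smul_one]
          exact Submodule.smul_mem _ _ h1
        · by_cases hi : i < n
          · rw [hxR i hi]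
            exact Submodule.subset_span ⟨⟨i, hi⟩, if_neg hi0.ne'⟩
          · rw [hxn i (by omega)]
            exact zero_mem _
    rintro z -
    obtain ⟨b, rfl⟩ := (toricMap k n le_rfl).rangeRestrict_surjective z
    refine hMe ?_
    have := htop ((bigRingEquiv k n).symm b)
    rwa [AlgEquiv.apply_symm_apply] at this
  let b : Module.Basis (Fin n) P (ToricRing k n) := Module.Basis.mk hli hspan
  exact ⟨alg, Module.Finite.of_basis b, Module.Free.of_basis b⟩

end ToricRing

/-! ### The symmetric algebra is Cohen–Macaulay -/

section SymmetricAlgebra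

/-- The symmetric algebra is Cohen–Macaulay, being the quotient by `h` of the toric ring, a domain
that is finite and free over a polynomial ring. -/
theorem isCohenMacaulay_symmetricAlgebra {k : Type*} [Field k] {n d : ℕ} (hn : 1 ≤ n)
    {f g : BaseRing k n} (hf0 : f ≠ 0) (hfg : IsRelPrime f g) {dg : Fin n → BaseRing k n}
    (hdg : IsPartialColumn d g dg) :
    IsCohenMacaulay (SymmetricAlgebra (BaseRing k n) (baseIdeal f g)) := by
  obtain ⟨alg, hfin, hfree⟩ := exists_algebra_toricRing_free (k := k) hn
  have hsurj : Function.Surjective (toToricRing k n) :=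
    (toricMap k n le_rfl).rangeRestrict_surjective
  have hker0 : ∀ b, toToricRing k n b = 0 ↔ toricMap k n le_rfl b = 0 := fun b =>
    ⟨fun h => congr_arg Subtype.val h, fun h => Subtype.ext h⟩
  have hle : RingHom.ker (toToricRing k n).toRingHom ≤
      RingHom.ker (symHom f g).toRingHom := fun b hb =>
    symIdeal_le_ker hdg (Ideal.mem_sup_left
      (mem_minorIdeal_of_toricMap_eq_zero k n le_rfl b ((hker0 b).1 hb)))
  let φ := RingHom.liftOfSurjective (toToricRing k n).toRingHom hsurj
    ⟨(symHom f g).toRingHom, hle⟩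
  have hφ : ∀ b, φ (toToricRing k n b) = symHom f g b := fun b =>
    RingHom.liftOfRightInverse_comp_apply _ _ _ ⟨(symHom f g).toRingHom, hle⟩ b
  refine isCohenMacaulay_of_surjective (k := k) (m := n + 1) φ ?_
    (h := toToricRing k n (hPoly f dg)) ?_ ?_
  · intro s
    obtain ⟨b, rfl⟩ := symHom_surjective f g s
    exact ⟨_, hφ b⟩
  · rw [Ne, hker0]
    exact toricMap_hPoly_ne_zero hf0 dg
  · intro a
    obtain ⟨b, rfl⟩ := hsurj a
    rw [hφ]
    constructor
    · intro hb
      obtain ⟨c, hc, e, he, rfl⟩ :=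
        Submodule.mem_sup.1 (mem_symIdeal_of_symHom_eq_zero hf0 hfg hdg hb)
      obtain ⟨u, rfl⟩ := Ideal.mem_span_singleton.1 he
      rw [map_add, (hker0 c).2 (toricMap_eq_zero_of_mem k n le_rfl hc), zero_add, map_mul]
      exact dvd_mul_right _ _
    · rintro ⟨u, hu⟩
      obtain ⟨u, rfl⟩ := hsurj u
      rw [← hφ, hu, map_mul, hφ, symIdeal_le_ker hdg
        (Ideal.mem_sup_right (Ideal.mem_span_singleton_self _)), zero_mul]

end SymmetricAlgebra

end DeJonquieres

theorem mainTheorem7 {k : Type*} [Field k] (n d : ℕ) (hn : 2 ≤ n) (hd : 2 ≤ d)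
    (f g : DeJonquieres.BaseRing k n)
    (hf : f.IsHomogeneous (d - 1)) (hg : g.IsHomogeneous d) (hfg : IsRelPrime f g) :
    -- a column `∂g` exists, and for every choice of it the mapping cone is a minimal resolution
    (∃ dg, DeJonquieres.IsPartialColumn d g dg) ∧
    (∀ dg, DeJonquieres.IsPartialColumn d g dg →
      DeJonquieres.IsMinimalBigradedFreeResolution
        (DeJonquieres.symPart f g)
        (DeJonquieres.ConeIndex n)
        (DeJonquieres.coneDeg n d)
        (DeJonquieres.coneD (DeJonquieres.psi k n) (DeJonquieres.hPoly f dg))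
        (DeJonquieres.coneAug f g)) ∧
    -- the resolution has length `n`
    (Nonempty (DeJonquieres.ConeIndex n n) ∧ ∀ i, n < i → IsEmpty (DeJonquieres.ConeIndex n i)) ∧
    -- the ranks and the twists of its modules
    (Finset.univ.val.map (DeJonquieres.coneDeg n d 0) = {(0, 0)} ∧
      Finset.univ.val.map (DeJonquieres.coneDeg n d 1) =
        {((d : ℤ) - 1, 1)} + Multiset.replicate (n.choose 2) (1, 1) ∧
      ∀ i, 2 ≤ i → i ≤ n →
        Finset.univ.val.map (DeJonquieres.coneDeg n d i) =
          ∑ a ∈ Finset.range (i - 1),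
            Multiset.replicate (n.choose i) ((d : ℤ) + a, (i : ℤ) - a) +
          ∑ a ∈ Finset.range i,
            Multiset.replicate (n.choose (i + 1)) ((a : ℤ) + 1, (i : ℤ) - a)) ∧
    DeJonquieres.IsCohenMacaulay
      (SymmetricAlgebra (DeJonquieres.BaseRing k n) (DeJonquieres.baseIdeal f g)) := by
  have hf0 := DeJonquieres.ne_zero_of_isRelPrime hd hg hfg
  obtain ⟨dg, hdg⟩ := DeJonquieres.exists_isPartialColumn (by omega) hg
  exact ⟨⟨dg, hdg⟩,
    fun _ hdg' => DeJonquieres.isMinimalBigradedFreeResolution hd hf hf0 hfg hdg',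
    ⟨DeJonquieres.nonempty_coneIndex hn, fun _ => DeJonquieres.isEmpty_coneIndex hn⟩,
    ⟨DeJonquieres.map_coneDeg_zero n d, DeJonquieres.map_coneDeg_one n d,
      fun i hi _ => DeJonquieres.map_coneDeg n d i hi⟩,
    DeJonquieres.isCohenMacaulay_symmetricAlgebra (by omega) hf0 hfg hdg⟩
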